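/- Let $K$ be an algebraically closed field and let $A$ be a finite dimensional basic $K$-algebra (for instance $A=KQ/\mathcal I$ for a finite quiver $Q$ and an admissible ideal $\mathcal I$) with a complete set of primitive orthogonal idempotents $e_i$, $i\in Q_0$; all modules are left modules. Let $P(i)=Ae_i$, $I(i)=\mathrm{Hom}_K(e_iA,K)$, $S(i)=\mathrm{top}\,P(i)$, $[M:S(i)]=\dim_K e_iM$, and let $\leqslant$ be a partial order on the finite set $Q_0$. The standard module $\Delta(i)$ is the largest factor module of $P(i)$, and the costandard module $\nabla(i)$ the largest submodule of $I(i)$, in which $S(j)$ has multiplicity $0$ for all $j\not\leqslant i$. A module is $\Delta$-good if it has a filtration whose subquotients are all isomorphic to standard modules; $(M:\Delta(k))$ is the number of subquotients isomorphic to $\Delta(k)$ in any such filtration of $M$. The notions for $\nabla$ are analogous. $(A,\leqslant)$ is quasi-hereditary if for all $i$: $[\Delta(i):S(i)]=1$, and $P(i)$ is $\Delta$-good with $(P(i):\Delta(i))=1$ and $(P(i):\Delta(j))=0$ for all $j\not\geqslant i$. It is 1-quasi-hereditary if moreover $Q_0$ has a smallest element $1$ and a largest element $n$; $[\Delta(i):S(j)]=(P(j):\Delta(i))=1$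 whenever $j\leqslant i$; $\mathrm{soc}\,P(j)\cong\mathrm{top}\,I(j)\cong S(1)$ for all $j$; and for all $i$ there are an injection $\Delta(i)\hookrightarrow\Delta(n)$ and a surjection $\nabla(n)\twoheadrightarrow\nabla(i)$. Let $(A,\leqslant)$ be 1-quasi-hereditary. Then for every $l\in Q_0$ there is a unique submodule of $P(1)$ isomorphic to $P(l)$, again denoted $P(l)$, and a unique submodule $\mathcal K(l)$ of $P(1)$ with $P(1)/\mathcal K(l)\cong I(l)$. For $\Lambda\subseteq Q_0$ put $\check\Lambda=\{k\in Q_0\mid k\geqslant i\text{ for some }i\in\Lambda\}$. Let $\Lambda_1,\Lambda_2\subseteq Q_0$ with $\check\Lambda_2\subseteq\check\Lambda_1$, and let $$M_v=\sum_{l\in\Lambda_v}P(l),\qquad N_v=\bigcap_{l\in\Lambda_v}\mathcal K(l)\qquad(v=1,2)$$ be the corresponding submodules of $P(1)$ (for $\Lambda_v=\emptyset$: $M_v=0$, $N_v=P(1)$). Then: (a) $M_2\subseteq M_1$, the module $M_1/M_2$ is $\Delta$-good, and for every $k\in Q_0$, $(M_1/M_2:\Delta(k))$ is well defined and equals $1$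 if $k\in\check\Lambda_1\setminus\check\Lambda_2$ and $0$ otherwise. (b) $N_1\subseteq N_2$, the module $N_2/N_1$ is $\nabla$-good, and for every $k\in Q_0$, $(N_2/N_1:\nabla(k))$ is well defined and equals $1$ if $k\in\check\Lambda_1\setminus\check\Lambda_2$ and $0$ otherwise. If $\check\Lambda_2\neq\check\Lambda_1$, both inclusions are strict. -/

import Mathlib

namespace QuasiHereditary

/-! ### Finite dimensional basic algebras with vertices

The vertices of the quiver are the elements of a finite type `ι`, and the trivial path at the vertex
`i` is an idempotent `e i` of `A`. All modules are left modules. -/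

/-- An idempotent is primitive if it is nonzero and is not a sum of two nonzero orthogonal
idempotents. -/
def IsPrimitiveIdempotent {A : Type*} [Ring A] (f : A) : Prop :=
  IsIdempotentElem f ∧ f ≠ 0 ∧
    ∀ g h : A, IsIdempotentElem g → IsIdempotentElem h → g * h = 0 → h * g = 0 → g + h = f →
      g = 0 ∨ h = 0

/-- The projective module `P(i) = A e_i`. -/
abbrev Proj {A ι : Type*} [Ring A] (e : ι → A) (i : ι) : Submodule A A :=
  Submodule.span A {e i}

/-- `A` is basic with vertex set `ι`: the `e i` are a complete set of primitive orthogonal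
idempotents, and the projective modules `A e_i` are pairwise non-isomorphic. -/
structure IsBasicVertexSystem {A ι : Type*} [Ring A] [Fintype ι] (e : ι → A) : Prop where
  complete : CompleteOrthogonalIdempotents e
  primitive : ∀ i, IsPrimitiveIdempotent (e i)
  basic : ∀ i j, Nonempty (Proj e i ≃ₗ[A] Proj e j) → i = j

/-! ### The injective modules -/

/-- The `K`-dual `D(A) = Hom_K(A, K)` of `A`, as a left `A`-module via `(a • f) x = f (x * a)`. -/
def RegDual (K A : Type*) [Field K] [Ring A] [Algebra K A] : Type _ := A →ₗ[K] K

section RegDual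

variable (K A : Type*) [Field K] [Ring A] [Algebra K A]

instance : AddCommGroup (RegDual K A) := inferInstanceAs (AddCommGroup (A →ₗ[K] K))

instance : Module K (RegDual K A) := inferInstanceAs (Module K (A →ₗ[K] K))

instance : FunLike (RegDual K A) A K := inferInstanceAs (FunLike (A →ₗ[K] K) A K)

instance : SMul A (RegDual K A) where
  smul a f := LinearMap.comp (show A →ₗ[K] K from f) (LinearMap.mulRight K a)

theorem RegDual.smul_apply (a : A) (f : RegDual K A) (x : A) : (a • f) x = f (x * a) := rfl

theorem RegDual.add_apply (f g : RegDual K A) (x : A) : (f + g) x = f x + g x := rfl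

theorem RegDual.zero_apply (x : A) : (0 : RegDual K A) x = 0 := rfl

theorem RegDual.ksmul_apply (c : K) (f : RegDual K A) (x : A) : (c • f) x = c * f x := rfl

theorem RegDual.map_add (f : RegDual K A) (x y : A) : f (x + y) = f x + f y :=
  LinearMap.map_add (show A →ₗ[K] K from f) x y

theorem RegDual.map_zero (f : RegDual K A) : f 0 = 0 :=
  LinearMap.map_zero (show A →ₗ[K] K from f)

theorem RegDual.map_ksmul (f : RegDual K A) (c : K) (x : A) : f (c • x) = c * f x :=
  LinearMap.map_smul (show A →ₗ[K] K from f) c x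

instance : Module A (RegDual K A) where
  one_smul f := DFunLike.ext _ _ fun x => by rw [RegDual.smul_apply, mul_one]
  mul_smul a b f := DFunLike.ext _ _ fun x => by simp only [RegDual.smul_apply, mul_assoc]
  smul_zero a := DFunLike.ext _ _ fun x => rfl
  smul_add a f g := DFunLike.ext _ _ fun x => rfl
  add_smul a b f := DFunLike.ext _ _ fun x => by
    simp only [RegDual.smul_apply, RegDual.add_apply, mul_add, RegDual.map_add]
  zero_smul f := DFunLike.ext _ _ fun x => by
    simp only [RegDual.smul_apply, RegDual.zero_apply, mul_zero, RegDual.map_zero]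

instance : IsScalarTower K A (RegDual K A) where
  smul_assoc c a f := DFunLike.ext _ _ fun x => by
    simp only [RegDual.smul_apply, RegDual.ksmul_apply, mul_smul_comm, RegDual.map_ksmul]

end RegDual

/-- The injective module `I(i) = D(e_i A)`. Since `A = e_i A ⊕ (1 - e_i) A`, a functional on `e_i A`
is the same as a functional `f` on `A` that vanishes on `(1 - e_i) A`, i.e. `f (e_i x) = f x`. -/
def Inj (K : Type*) {A ι : Type*} [Field K] [Ring A] [Algebra K A] (e : ι → A) (i : ι) :
    Submodule A (RegDual K A) where
  carrier := {f | ∀ x : A, f (e i * x) = f x}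
  add_mem' := fun hf hg x => by rw [RegDual.add_apply, RegDual.add_apply, hf x, hg x]
  zero_mem' := fun _ => rfl
  smul_mem' := fun a f hf x => by
    rw [RegDual.smul_apply, RegDual.smul_apply, mul_assoc]; exact hf (x * a)

/-! ### Tops, socles, multiplicities of simple modules -/

/-- The top `M / rad M` of a module, `rad M` being the intersection of the maximal submodules. -/
abbrev ModTop (A M : Type*) [Ring A] [AddCommGroup M] [Module A M] : Type _ :=
  M ⧸ Module.jacobson A M

/-- The socle of a module: the sum of its simple submodules. -/
def socle (A M : Type*) [Ring A] [AddCommGroup M] [Module A M] : Submodule A M :=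
  sSup {N : Submodule A M | IsSimpleModule A N}

/-- The simple module `S(i)`, the top of `P(i)`. -/
abbrev Simp {A ι : Type*} [Ring A] (e : ι → A) (i : ι) : Type _ := ModTop A (Proj e i)

/-- The multiplicity `[M : S(j)] = dim_K (e_j M)`. -/
noncomputable def simpleMult (K : Type*) {A ι : Type*} [Field K] [Ring A] [Algebra K A] (e : ι → A)
    (M : Type*) [AddCommGroup M] [Module K M] [Module A M] [IsScalarTower K A M] (j : ι) : ℕ :=
  Module.finrank K (LinearMap.range (Algebra.lsmul K K M (e j)))

/-! ### Standard and costandard modules -/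

section Standard

variable (K : Type*) {A ι : Type*} [Field K] [Ring A] [Algebra K A] [PartialOrder ι]

/-- The smallest submodule `N` of `P(i)` such that `[P(i)/N : S(j)] = 0` for all `j` with
`¬ j ≤ i` (see `isLeast_standardKer`). -/
def standardKer (e : ι → A) (i : ι) : Submodule A (Proj e i) :=
  sInf {N : Submodule A (Proj e i) | ∀ j, ¬ j ≤ i → simpleMult K e (Proj e i ⧸ N) j = 0}

/-- The standard module `Δ(i)`: the largest factor module of `P(i)` such that `[Δ(i) : S(j)] = 0`
for all `j` with `¬ j ≤ i`. -/
abbrev Standard (e : ι → A) (i : ι) : Type _ := Proj e i ⧸ standardKer K e i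

/-- The costandard module `∇(i)`: the largest submodule of `I(i)` such that `[∇(i) : S(j)] = 0` for
all `j` with `¬ j ≤ i` (see `isGreatest_costandard`). -/
def Costandard (e : ι → A) (i : ι) : Submodule A (Inj K e i) :=
  sSup {N : Submodule A (Inj K e i) | ∀ j, ¬ j ≤ i → simpleMult K e N j = 0}

end Standard

section WellDefined

variable (K : Type*) {A ι : Type*} [Field K] [Ring A] [Algebra K A]

theorem simpleMult_eq_zero_iff (e : ι → A) (M : Type*) [AddCommGroup M] [Module K M] [Module A M]
    [IsScalarTower K A M] [Module.Finite K M] (j : ι) :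
    simpleMult K e M j = 0 ↔ ∀ m : M, e j • m = 0 := by
  rw [simpleMult, Submodule.finrank_eq_zero, LinearMap.range_eq_bot, LinearMap.ext_iff]
  rfl

theorem finite_submodule {M : Type*} [AddCommGroup M] [Module K M] [Module A M]
    [IsScalarTower K A M] [Module.Finite K M] (N : Submodule A M) : Module.Finite K N :=
  Module.Finite.of_injective (N.subtype.restrictScalars K) N.injective_subtype

theorem finite_quotient {M : Type*} [AddCommGroup M] [Module K M] [Module A M]
    [IsScalarTower K A M] [Module.Finite K M] (N : Submodule A M) : Module.Finite K (M ⧸ N) :=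
  Module.Finite.of_surjective (N.mkQ.restrictScalars K) N.mkQ_surjective

instance [Module.Finite K A] : Module.Finite K (RegDual K A) :=
  inferInstanceAs (Module.Finite K (A →ₗ[K] K))

variable [PartialOrder ι] [Module.Finite K A]

theorem isLeast_standardKer (e : ι → A) (i : ι) :
    IsLeast {N : Submodule A (Proj e i) | ∀ j, ¬ j ≤ i → simpleMult K e (Proj e i ⧸ N) j = 0}
      (standardKer K e i) := by
  have := finite_submodule K (Proj e i)
  refine ⟨fun j hj => ?_, fun N hN => sInf_le hN⟩
  have := finite_quotient K (standardKer K e i)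
  rw [simpleMult_eq_zero_iff]
  intro m
  obtain ⟨m, rfl⟩ := Submodule.Quotient.mk_surjective _ m
  rw [← Submodule.Quotient.mk_smul, Submodule.Quotient.mk_eq_zero, standardKer, Submodule.mem_sInf]
  intro N hN
  have := finite_quotient K N
  have h := (simpleMult_eq_zero_iff K e _ j).1 (hN j hj) (Submodule.Quotient.mk m)
  rwa [← Submodule.Quotient.mk_smul, Submodule.Quotient.mk_eq_zero] at h

theorem isGreatest_costandard (e : ι → A) (i : ι) :
    IsGreatest {N : Submodule A (Inj K e i) | ∀ j, ¬ j ≤ i → simpleMult K e N j = 0}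
      (Costandard K e i) := by
  have := finite_submodule K (Inj K e i)
  refine ⟨fun j hj => ?_, fun N hN => le_sSup hN⟩
  have := finite_submodule K (Costandard K e i)
  rw [simpleMult_eq_zero_iff]
  rintro ⟨m, hm⟩
  apply Subtype.ext
  change e j • m = 0
  rw [Costandard, sSup_eq_iSup'] at hm
  induction hm using Submodule.iSup_induction' with
  | mem N x hx =>
    have := finite_submodule K N.1
    exact congrArg Subtype.val ((simpleMult_eq_zero_iff K e N.1 j).1 (N.2 j hj) ⟨x, hx⟩)
  | zero => exact smul_zero _
  | add x y _ _ hx hy => rw [smul_add, hx, hy, add_zero]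

end WellDefined

/-! ### Good filtrations -/

section Good

variable (A : Type*) {ι : Type*} [Ring A] (X : ι → Type*) [∀ i, AddCommGroup (X i)] [∀ i, Module A (X i)]
  (M : Type*) [AddCommGroup M] [Module A M]

/-- `0 = F 0 ⊆ F 1 ⊆ ⋯ ⊆ F r = M` is a filtration of `M` in which every subquotient
`F (t+1) / F t` is isomorphic to some `X i` (the values `F t` with `t > r` play no role). -/
def IsGoodFiltration (r : ℕ) (F : ℕ → Submodule A M) : Prop :=
  F 0 = ⊥ ∧ F r = ⊤ ∧ ∀ t < r, F t ≤ F (t + 1) ∧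
    ∃ i, Nonempty ((F (t + 1) ⧸ (F t).submoduleOf (F (t + 1))) ≃ₗ[A] X i)

/-- `M` belongs to `𝔉(X)`: it has a filtration with all subquotients among the `X i`. -/
def IsGood : Prop := ∃ (r : ℕ) (F : ℕ → Submodule A M), IsGoodFiltration A X M r F

variable {A M} in
/-- The number of subquotients isomorphic to `X k` in a filtration of length `r`. -/
noncomputable def filtrationMult (r : ℕ) (F : ℕ → Submodule A M) (k : ι) : ℕ :=
  Set.ncard {t : ℕ | t < r ∧
    Nonempty ((F (t + 1) ⧸ (F t).submoduleOf (F (t + 1))) ≃ₗ[A] X k)}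

/-- `M` belongs to `𝔉(X)` and `(M : X k) = c`: good filtrations exist, and in each of them exactly
`c` subquotients are isomorphic to `X k`. -/
def HasGoodMult (k : ι) (c : ℕ) : Prop :=
  IsGood A X M ∧ ∀ (r : ℕ) (F : ℕ → Submodule A M), IsGoodFiltration A X M r F →
    filtrationMult X r F k = c

end Good

/-! ### Quasi-hereditary and 1-quasi-hereditary algebras -/

section QH

variable (K : Type*) {A ι : Type*} [Field K] [Ring A] [Algebra K A] [PartialOrder ι]

/-- `(A, ≤)` is quasi-hereditary. -/
structure IsQuasiHereditary (e : ι → A) : Prop where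
  standard_self : ∀ i, simpleMult K e (Standard K e i) i = 1
  proj_good : ∀ i, IsGood A (Standard K e) (Proj e i)
  proj_mult_zero : ∀ i j, ¬ i ≤ j → HasGoodMult A (Standard K e) (Proj e i) j 0
  proj_mult_self : ∀ i, HasGoodMult A (Standard K e) (Proj e i) i 1

/-- `(A, ≤)` is 1-quasi-hereditary. The smallest vertex (called `1` in the literature) is `⊥`, the
largest vertex (called `n`) is `⊤`. -/
structure IsOneQuasiHereditary [Fintype ι] [BoundedOrder ι] (e : ι → A) : Prop extends
    IsBasicVertexSystem e, IsQuasiHereditary K e where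
  standard_mult : ∀ i j, j ≤ i → simpleMult K e (Standard K e i) j = 1
  proj_mult : ∀ i j, j ≤ i → HasGoodMult A (Standard K e) (Proj e j) i 1
  socle_proj : ∀ j, Nonempty (socle A (Proj e j) ≃ₗ[A] Simp e (⊥ : ι))
  top_inj : ∀ j, Nonempty (ModTop A (Inj K e j) ≃ₗ[A] Simp e (⊥ : ι))
  standard_embeds : ∀ i, ∃ f : Standard K e i →ₗ[A] Standard K e (⊤ : ι), Function.Injective f
  costandard_covers : ∀ i,
    ∃ f : Costandard K e (⊤ : ι) →ₗ[A] Costandard K e i, Function.Surjective f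

end QH

/-! ### The submodules of `P(1)` -/

/-- The set `Λ̌ = ⋃_{i ∈ Λ} {k | i ≤ k}`. -/
def upClosure {ι : Type*} [PartialOrder ι] (L : Set ι) : Set ι := ⋃ i ∈ L, Set.Ici i

section Submodules

variable {A ι : Type*} [Ring A] [PartialOrder ι] [OrderBot ι]

/-- `P(l)` as a submodule of `P(1)`: the submodule of `P(1)` isomorphic to `P(l)`
(if it is not unique, the sum of all such submodules). -/
def projIn (e : ι → A) (l : ι) : Submodule A (Proj e (⊥ : ι)) :=
  sSup {N | Nonempty (N ≃ₗ[A] Proj e l)}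

/-- `∑_{l ∈ Λ} P(l)` inside `P(1)`. -/
def projSum (e : ι → A) (L : Set ι) : Submodule A (Proj e (⊥ : ι)) := ⨆ l ∈ L, projIn e l

variable (K : Type*) [Field K] [Algebra K A]

/-- `𝒦(l)`, the kernel of a surjection `P(1) → I(l)`: the submodule `N` of `P(1)` with
`P(1)/N ≅ I(l)` (if it is not unique, the intersection of all such submodules). -/
def injKer (e : ι → A) (l : ι) : Submodule A (Proj e (⊥ : ι)) :=
  sInf {N | Nonempty ((Proj e (⊥ : ι) ⧸ N) ≃ₗ[A] Inj K e l)}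

/-- `⋂_{l ∈ Λ} 𝒦(l)` inside `P(1)`. -/
def injKerInf (e : ι → A) (L : Set ι) : Submodule A (Proj e (⊥ : ι)) := ⨅ l ∈ L, injKer K e l

end Submodules

end QuasiHereditary

open QuasiHereditary

/-! Everything reduces to counting composition factors. The `Δ`-filtration of `P(j)` has `Δ(i)` once
for each `i ≥ j`, and `Δ(i)` contains `S(k)` once for each `k ≤ i`, so `[P(j) : S(k)] = [I(j) :
S(k)]` is the number of `i` above both `j` and `k`. For `j = 1` this is the number of `i ≥ k`, hence
for `k ≥ l` the module `P(l)` has as many factors `S(k)` as `P(1)`. This forces any copy of `P(l)`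
in `P(1)` to be `A e_l P(1)` and any kernel of `P(1) → I(l)` to be the largest submodule without
factor `S(l)`; both are therefore unique, and `M_v`, `N_v` depend only on the upper set generated by
`Λ_v`. Existence uses the simple socle of `P(l)`, which gives `P(l) ↪ I(1) ≅ P(1)`, and the simple
top of `I(l)`.

Now add a minimal element `m` to an upper set. The key inclusion `smul_mem_generatedAt_Ici_inter`
shows that the sum grows by a quotient of `Δ(m)` and that the intersection shrinks by a submodule of
`∇(m)`. Each step thus accounts for `S(k)` at most once, and only if `k ≤ m`. From the empty set to
all vertices the total must be `[P(1) : S(k)]`, which leaves no slack (`eq_ncard_of_step`), so every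
step is exactly `Δ(m)` or `∇(m)`. Filtration multiplicities are then recovered from simple
multiplicities by unitriangularity. -/

namespace QuasiHereditary

attribute [local instance] finite_submodule finite_quotient

/-! ### Multiplicities of simple modules -/

section SimpleMult

variable {K A ι : Type*} [Field K] [Ring A] [Algebra K A] {e : ι → A}
  {M N : Type*} [AddCommGroup M] [Module K M] [Module A M] [IsScalarTower K A M]
  [AddCommGroup N] [Module K N] [Module A N] [IsScalarTower K A N]

/-- Multiplicities of simple modules are isomorphism invariant. -/
theorem simpleMult_congr (f : M ≃ₗ[A] N) (j : ι) : simpleMult K e M j = simpleMult K e N j := by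
  have h : LinearMap.range (Algebra.lsmul K K N (e j)) =
      (LinearMap.range (Algebra.lsmul K K M (e j))).map (f.restrictScalars K).toLinearMap := by
    ext y
    constructor
    · rintro ⟨y, rfl⟩
      exact ⟨e j • f.symm y, ⟨f.symm y, rfl⟩, by simp⟩
    · rintro ⟨_, ⟨x, rfl⟩, rfl⟩
      exact ⟨f x, by simp⟩
  rw [simpleMult, simpleMult, h]
  exact (LinearEquiv.finrank_map_eq (f.restrictScalars K) _).symm

/-- Multiplicities of simple modules are additive on short exact sequences. -/
theorem simpleMult_eq_add [Module.Finite K M] (L : Submodule A M) {j : ι}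
    (hj : IsIdempotentElem (e j)) :
    simpleMult K e M j = simpleMult K e L j + simpleMult K e (M ⧸ L) j := by
  let p : M →ₗ[K] M ⧸ L := L.mkQ.restrictScalars K
  let R := LinearMap.range (Algebra.lsmul K K M (e j))
  -- Rank-nullity for `e_j M → M / L`: the image is `e_j (M / L)`, and the kernel `e_j M ∩ L` is
  -- `e_j L` because `e_j` is idempotent.
  have h := LinearMap.finrank_range_add_finrank_ker (p.domRestrict R)
  have h₁ : LinearMap.range (p.domRestrict R) =
      LinearMap.range (Algebra.lsmul K K (M ⧸ L) (e j)) := by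
    ext y
    constructor
    · rintro ⟨⟨_, x, rfl⟩, rfl⟩
      exact ⟨p x, rfl⟩
    · rintro ⟨y, rfl⟩
      obtain ⟨x, rfl⟩ := L.mkQ_surjective y
      exact ⟨⟨_, x, rfl⟩, rfl⟩
  have h₂ : (LinearMap.ker (p.domRestrict R)).map R.subtype =
      (LinearMap.range (Algebra.lsmul K K L (e j))).map (L.subtype.restrictScalars K) := by
    ext y
    constructor
    · rintro ⟨⟨_, x, rfl⟩, hx, rfl⟩
      have hx' : e j • x ∈ L := (Submodule.Quotient.mk_eq_zero L).1 hx
      refine ⟨_, ⟨⟨e j • x, hx'⟩, rfl⟩, ?_⟩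
      simp [← mul_smul, hj.eq]
    · rintro ⟨_, ⟨x, rfl⟩, rfl⟩
      exact ⟨⟨_, x, rfl⟩, (Submodule.Quotient.mk_eq_zero L).2 (L.smul_mem _ x.2), rfl⟩
  have h₃ := (Submodule.finrank_map_subtype_eq R (LinearMap.ker (p.domRestrict R))).symm
  rw [h₂] at h₃
  have h₄ := LinearEquiv.finrank_eq (Submodule.equivMapOfInjective (L.subtype.restrictScalars K)
    L.injective_subtype (LinearMap.range (Algebra.lsmul K K L (e j))))
  rw [simpleMult, simpleMult, simpleMult, ← h₁, h₄, ← h₃, add_comm]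
  exact h.symm

theorem simpleMult_le_of_injective [Module.Finite K N] (f : M →ₗ[A] N)
    (hf : Function.Injective f) {j : ι} (hj : IsIdempotentElem (e j)) :
    simpleMult K e M j ≤ simpleMult K e N j := by
  rw [simpleMult_eq_add (LinearMap.range f) hj, simpleMult_congr (LinearEquiv.ofInjective f hf)]
  exact Nat.le_add_right _ _

theorem simpleMult_le_of_surjective [Module.Finite K M] (f : M →ₗ[A] N)
    (hf : Function.Surjective f) {j : ι} (hj : IsIdempotentElem (e j)) :
    simpleMult K e N j ≤ simpleMult K e M j := by
  rw [simpleMult_eq_add (LinearMap.ker f) hj, simpleMult_congr (f.quotKerEquivOfSurjective hf)]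
  exact Nat.le_add_left _ _

theorem simpleMult_submoduleOf [Module.Finite K M] {B C : Submodule A M} (h : B ≤ C) {j : ι}
    (hj : IsIdempotentElem (e j)) :
    simpleMult K e C j = simpleMult K e B j + simpleMult K e (C ⧸ B.submoduleOf C) j := by
  rw [simpleMult_eq_add (B.submoduleOf C) hj,
    simpleMult_congr (Submodule.submoduleOfEquivOfLe h)]

theorem simpleMult_top (j : ι) :
    simpleMult K e (⊤ : Submodule A M) j = simpleMult K e M j :=
  simpleMult_congr Submodule.topEquiv j

theorem simpleMult_bot (j : ι) : simpleMult K e (⊥ : Submodule A M) j = 0 :=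
  Module.finrank_zero_of_subsingleton

theorem smul_eq_zero_of_simpleMult_eq_zero [Module.Finite K M] {j : ι}
    (h : simpleMult K e M j = 0) (x : M) : e j • x = 0 :=
  (simpleMult_eq_zero_iff K e M j).1 h x

theorem smul_mem_of_simpleMult_eq [Module.Finite K M] (L : Submodule A M) {j : ι}
    (hj : IsIdempotentElem (e j)) (h : simpleMult K e L j = simpleMult K e M j) (x : M) :
    e j • x ∈ L := by
  have h₀ : simpleMult K e (M ⧸ L) j = 0 := by
    have := simpleMult_eq_add (K := K) L hj
    lia
  exact (Submodule.Quotient.mk_eq_zero L).1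
    (smul_eq_zero_of_simpleMult_eq_zero h₀ (Submodule.Quotient.mk x))

variable [Fintype ι]

theorem sum_smul_eq (he : CompleteOrthogonalIdempotents e) (x : M) : ∑ j, e j • x = x := by
  rw [← Finset.sum_smul, he.complete, one_smul]

theorem surjective_of_simpleMult_eq [Module.Finite K N] (he : CompleteOrthogonalIdempotents e)
    (f : M →ₗ[A] N) (hf : Function.Injective f)
    (h : ∀ j, simpleMult K e M j = simpleMult K e N j) : Function.Surjective f := by
  intro y
  change y ∈ LinearMap.range f
  rw [← sum_smul_eq he y]
  refine Submodule.sum_mem _ fun j _ => ?_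
  exact smul_mem_of_simpleMult_eq (K := K) _ (he.idem j)
    ((simpleMult_congr (LinearEquiv.ofInjective f hf) j).symm.trans (h j)) y

theorem injective_of_simpleMult_eq [Module.Finite K M] (he : CompleteOrthogonalIdempotents e)
    (f : M →ₗ[A] N) (hf : Function.Surjective f)
    (h : ∀ j, simpleMult K e M j = simpleMult K e N j) : Function.Injective f := by
  rw [injective_iff_map_eq_zero]
  intro x hx
  have h₀ : ∀ j, simpleMult K e (LinearMap.ker f) j = 0 := fun j => by
    have h₁ := simpleMult_eq_add (K := K) (LinearMap.ker f) (he.idem j)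
    rw [simpleMult_congr (f.quotKerEquivOfSurjective hf), h j] at h₁
    lia
  have h₂ := sum_smul_eq he (⟨x, hx⟩ : LinearMap.ker f)
  simp only [smul_eq_zero_of_simpleMult_eq_zero (h₀ _), Finset.sum_const_zero] at h₂
  exact congrArg Subtype.val h₂.symm

end SimpleMult

/-! ### Good filtrations and their multiplicities -/

section Filtration

variable {K A ι : Type*} [Field K] [Ring A] [Algebra K A] {e : ι → A}
  {X : ι → Type*} [∀ i, AddCommGroup (X i)] [∀ i, Module A (X i)]
  {M : Type*} [AddCommGroup M] [Module A M]

/-- `C / B` is isomorphic to one of the modules `X i`. -/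
def IsStep (X : ι → Type*) [∀ i, AddCommGroup (X i)] [∀ i, Module A (X i)]
    (B C : Submodule A M) : Prop :=
  B ≤ C ∧ ∃ i, Nonempty ((C ⧸ B.submoduleOf C) ≃ₗ[A] X i)

/-- A subquotient `S / T` between `B` and `C` is a subquotient of `C / B`. -/
theorem nonempty_equiv_map_mkQ {B T S C : Submodule A M} (hBT : B ≤ T) (hSC : S ≤ C) :
    Nonempty ((S ⧸ T.submoduleOf S) ≃ₗ[A]
      ((S.submoduleOf C).map (B.submoduleOf C).mkQ ⧸
        ((T.submoduleOf C).map (B.submoduleOf C).mkQ).submoduleOf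
          ((S.submoduleOf C).map (B.submoduleOf C).mkQ))) := by
  let q := (B.submoduleOf C).mkQ
  let S' := (S.submoduleOf C).map q
  let T' := (T.submoduleOf C).map q
  let f : S →ₗ[A] S' := (q ∘ₗ Submodule.inclusion hSC).codRestrict S' fun x =>
    ⟨Submodule.inclusion hSC x, x.2, rfl⟩
  have hf : Function.Surjective ((T'.submoduleOf S').mkQ ∘ₗ f) := by
    refine (Submodule.mkQ_surjective _).comp ?_
    rintro ⟨_, ⟨x, hx⟩, hxS, rfl⟩
    exact ⟨⟨x, hxS⟩, rfl⟩
  have hk : T.submoduleOf S = LinearMap.ker ((T'.submoduleOf S').mkQ ∘ₗ f) := by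
    ext x
    rw [LinearMap.mem_ker, LinearMap.comp_apply, Submodule.mkQ_apply,
      Submodule.Quotient.mk_eq_zero]
    constructor
    · intro hx
      exact ⟨Submodule.inclusion hSC x, hx, rfl⟩
    · rintro ⟨y, hy, hyx⟩
      have h : y - Submodule.inclusion hSC x ∈ B.submoduleOf C :=
        (Submodule.Quotient.eq _).1 hyx
      have h' : (x : M) = y - (y - x) := by abel
      change (x : M) ∈ T
      rw [h']
      exact T.sub_mem hy (hBT h)
  exact ⟨(Submodule.quotEquivOfEq _ _ hk).trans (LinearMap.quotKerEquivOfSurjective _ hf)⟩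

theorem exists_chain {B C : Submodule A M} (h : Relation.ReflTransGen (IsStep X) B C) :
    ∃ (r : ℕ) (H : ℕ → Submodule A M), H 0 = B ∧ H r = C ∧ ∀ t < r, IsStep X (H t) (H (t + 1)) := by
  induction h with
  | refl => exact ⟨0, fun _ => B, rfl, rfl, fun t ht => absurd ht (Nat.not_lt_zero t)⟩
  | @tail C D _ hCD ih =>
    obtain ⟨r, H, h0, hr, hH⟩ := ih
    refine ⟨r + 1, fun t => if t ≤ r then H t else D, by simpa, by simp, fun t ht => ?_⟩
    rcases Nat.lt_succ_iff_lt_or_eq.1 ht with ht | rfl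
    · simpa [ht.le, Nat.succ_le_of_lt ht] using hH t ht
    · simpa [hr] using hCD

/-- A chain of submodules with subquotients among the `X i` yields a good filtration. -/
theorem isGood_of_chain {B C : Submodule A M} (h : Relation.ReflTransGen (IsStep X) B C) :
    IsGood A X (C ⧸ B.submoduleOf C) := by
  obtain ⟨r, H, rfl, rfl, hH⟩ := exists_chain h
  have hmono : ∀ s t, s ≤ t → t ≤ r → H s ≤ H t := by
    intro s t hst
    induction t, hst using Nat.le_induction with
    | base => exact fun _ => le_rfl
    | succ t _ ih => exact fun ht => (ih (by lia)).trans (hH t (by lia)).1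
  refine ⟨r, fun t => ((H t).submoduleOf (H r)).map ((H 0).submoduleOf (H r)).mkQ, ?_, ?_, ?_⟩
  · exact (Submodule.map_le_iff_le_comap.2 (by
      rw [← LinearMap.ker, Submodule.ker_mkQ])).antisymm bot_le
  · change ((H r).submoduleOf (H r)).map _ = ⊤
    rw [Submodule.submoduleOf_self, Submodule.map_top, Submodule.range_mkQ]
  · intro t ht
    refine ⟨Submodule.map_mono (Submodule.comap_mono (hH t ht).1), ?_⟩
    obtain ⟨i, ⟨φ⟩⟩ := (hH t ht).2
    obtain ⟨ψ⟩ := nonempty_equiv_map_mkQ (hmono 0 t (by lia) (by lia)) (hmono (t + 1) r (by lia) le_rfl)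
    exact ⟨i, ⟨ψ.symm.trans φ⟩⟩

variable [∀ i, Module K (X i)] [∀ i, IsScalarTower K A (X i)] [Module K M] [IsScalarTower K A M]
  [Module.Finite K M]

theorem simpleMult_filtration {r : ℕ} {F : ℕ → Submodule A M} (h0 : F 0 = ⊥)
    (hF : ∀ t < r, F t ≤ F (t + 1)) {k : ι} (hk : IsIdempotentElem (e k)) :
    simpleMult K e (F r) k =
      ∑ t ∈ Finset.range r, simpleMult K e (F (t + 1) ⧸ (F t).submoduleOf (F (t + 1))) k := by
  induction r with
  | zero => rw [h0, simpleMult_bot, Finset.sum_range_zero]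
  | succ r ih =>
    rw [Finset.sum_range_succ, ← ih fun t ht => hF t (by lia)]
    exact simpleMult_submoduleOf (hF r (by lia)) hk

variable [Fintype ι] [PartialOrder ι]

open Classical in
theorem simpleMult_eq_sum_filtrationMult (he : ∀ k, IsIdempotentElem (e k))
    (hX : ∀ i k, simpleMult K e (X i) k = if k ≤ i then 1 else 0)
    {r : ℕ} {F : ℕ → Submodule A M} (hF : IsGoodFiltration A X M r F) (k : ι) :
    simpleMult K e M k = ∑ i, if k ≤ i then filtrationMult X r F i else 0 := by
  obtain ⟨h0, hr, hF⟩ := hF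
  -- The label of a subquotient is unique: an isomorphism `X i ≃ X j` puts `S(i)` into `X j` and
  -- `S(j)` into `X i`, so `i ≤ j ≤ i`.
  have hinj : ∀ i j, Nonempty (X i ≃ₗ[A] X j) → i = j := by
    rintro i j ⟨φ⟩
    have h₁ := simpleMult_congr (K := K) (e := e) φ i
    have h₂ := simpleMult_congr (K := K) (e := e) φ j
    simp only [hX, le_refl, if_true] at h₁ h₂
    refine le_antisymm ?_ ?_ <;> by_contra h <;> simp [h] at h₁ h₂
  have : Nonempty ι := ⟨k⟩
  choose! hle c hc using hF
  have hm : ∀ i, filtrationMult X r F i = ((Finset.range r).filter fun t => c t = i).card := by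
    intro i
    rw [filtrationMult, ← Set.ncard_coe_finset]
    congr 1
    ext t
    simp only [Set.mem_ofPred_eq, Finset.coe_filter, Finset.mem_range]
    refine and_congr_right fun ht => ⟨?_, ?_⟩
    · rintro ⟨φ⟩
      obtain ⟨ψ⟩ := hc t ht
      exact hinj _ _ ⟨ψ.symm.trans φ⟩
    · rintro rfl
      exact hc t ht
  rw [← simpleMult_top, ← hr, simpleMult_filtration h0 hle (he k)]
  have h₁ : ∀ t ∈ Finset.range r,
      simpleMult K e (F (t + 1) ⧸ (F t).submoduleOf (F (t + 1))) k = if k ≤ c t then 1 else 0 := by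
    intro t ht
    obtain ⟨ψ⟩ := hc t (Finset.mem_range.1 ht)
    rw [simpleMult_congr ψ, hX]
  rw [Finset.sum_congr rfl h₁,
    ← Finset.sum_fiberwise_of_maps_to (t := Finset.univ) (g := c) fun t _ => Finset.mem_univ _]
  refine Finset.sum_congr rfl fun i _ => ?_
  rw [hm, Finset.sum_congr rfl fun t ht => by rw [(Finset.mem_filter.1 ht).2]]
  split_ifs <;> simp

open Classical in
/-- A function on a finite poset is determined by its sums over principal upper sets. -/
theorem eq_of_sum_Ici_eq {c d : ι → ℕ}
    (h : ∀ k, ∑ i, (if k ≤ i then c i else 0) = ∑ i, if k ≤ i then d i else 0) (k : ι) :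
    c k = d k := by
  -- Downward induction: in the sum over `i ≥ k` all terms with `i > k` already agree.
  induction k using WellFoundedGT.induction with
  | _ k ih =>
    have hk := h k
    rw [← Finset.add_sum_erase _ _ (Finset.mem_univ k),
      ← Finset.add_sum_erase _ _ (Finset.mem_univ k)] at hk
    have hs : ∑ i ∈ Finset.univ.erase k, (if k ≤ i then c i else 0) =
        ∑ i ∈ Finset.univ.erase k, if k ≤ i then d i else 0 := by
      refine Finset.sum_congr rfl fun i hi => ?_
      split_ifs with hki
      · exact ih i (lt_of_le_of_ne hki (Finset.ne_of_mem_erase hi).symm)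
      · rfl
    simpa [hs] using hk

open Classical in
/-- Filtration multiplicities can be read off from the multiplicities of the simple modules. -/
theorem hasGoodMult_of_simpleMult (he : ∀ k, IsIdempotentElem (e k))
    (hX : ∀ i k, simpleMult K e (X i) k = if k ≤ i then 1 else 0) (hM : IsGood A X M)
    {c : ι → ℕ} (h : ∀ k, simpleMult K e M k = ∑ i, if k ≤ i then c i else 0) (k : ι) :
    HasGoodMult A X M k (c k) :=
  ⟨hM, fun _ _ hF => eq_of_sum_Ici_eq
    (fun j => (simpleMult_eq_sum_filtrationMult he hX hF j).symm.trans (h j)) k⟩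

end Filtration

/-! ### Submodules generated by, or without, given composition factors -/

section Generated

variable {A ι : Type*} [Ring A] (e : ι → A) (S : Set ι)
  (M : Type*) {N : Type*} [AddCommGroup M] [Module A M] [AddCommGroup N] [Module A N]

/-- The submodule `∑_{i ∈ S} A e_i M` of `M`. -/
def generatedAt : Submodule A M := Submodule.span A {x | ∃ i ∈ S, e i • x = x}

/-- The largest submodule of `M` without composition factors `S(i)` for `i ∈ S`. -/
def vanishingAt : Submodule A M where
  carrier := {x | ∀ i ∈ S, ∀ a : A, e i • a • x = 0}
  add_mem' hx hy i hi a := by rw [smul_add, smul_add, hx i hi, hy i hi, add_zero]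
  zero_mem' i _ a := by rw [smul_zero, smul_zero]
  smul_mem' b x hx i hi a := by rw [smul_smul a b]; exact hx i hi (a * b)

variable {e S M}

theorem mem_vanishingAt {x : M} :
    x ∈ vanishingAt e S M ↔ ∀ i ∈ S, ∀ a : A, e i • a • x = 0 := Iff.rfl

theorem smul_mem_generatedAt {i : ι} (hi : i ∈ S) (he : IsIdempotentElem (e i)) (x : M) :
    e i • x ∈ generatedAt e S M :=
  Submodule.subset_span ⟨i, hi, by rw [smul_smul, he.eq]⟩

theorem generatedAt_mono {T : Set ι} (h : S ⊆ T) : generatedAt e S M ≤ generatedAt e T M :=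
  Submodule.span_mono fun _ ⟨i, hi, hx⟩ => ⟨i, h hi, hx⟩

theorem vanishingAt_anti {T : Set ι} (h : S ⊆ T) : vanishingAt e T M ≤ vanishingAt e S M :=
  fun _ hx i hi => hx i (h hi)

theorem generatedAt_empty : generatedAt e ∅ M = ⊥ := by
  simp [generatedAt]

theorem vanishingAt_empty : vanishingAt e ∅ M = ⊤ :=
  eq_top_iff.2 fun _ _ _ hi => hi.elim

theorem generatedAt_union (S T : Set ι) :
    generatedAt e (S ∪ T) M = generatedAt e S M ⊔ generatedAt e T M := by
  rw [generatedAt, generatedAt, generatedAt, ← Submodule.span_union]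
  congr 1
  ext x
  simp only [Set.mem_ofPred_eq, Set.mem_union]
  grind

theorem generatedAt_eq_iSup (S : Set ι) :
    generatedAt e S M = ⨆ i ∈ S, generatedAt e {i} M := by
  refine le_antisymm (Submodule.span_le.2 ?_)
    (iSup₂_le fun i hi => generatedAt_mono (Set.singleton_subset_iff.2 hi))
  rintro x ⟨i, hi, hx⟩
  exact le_iSup₂ (f := fun i (_ : i ∈ S) => generatedAt e {i} M) i hi
    (Submodule.subset_span ⟨i, rfl, hx⟩)

theorem vanishingAt_eq_iInf (S : Set ι) :
    vanishingAt e S M = ⨅ i ∈ S, vanishingAt e {i} M := by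
  ext x
  simp [mem_vanishingAt]

theorem map_generatedAt_le (f : M →ₗ[A] N) :
    (generatedAt e S M).map f ≤ generatedAt e S N := by
  rw [generatedAt, Submodule.map_span_le]
  rintro x ⟨i, hi, hx⟩
  exact Submodule.subset_span ⟨i, hi, by rw [← map_smul, hx]⟩

theorem map_generatedAt_of_surjective (he : ∀ i, IsIdempotentElem (e i)) (f : M →ₗ[A] N)
    (hf : Function.Surjective f) : (generatedAt e S M).map f = generatedAt e S N := by
  refine le_antisymm (map_generatedAt_le f) (Submodule.span_le.2 ?_)
  rintro y ⟨i, hi, hy⟩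
  obtain ⟨x, rfl⟩ := hf y
  exact ⟨e i • x, smul_mem_generatedAt hi (he i) x, by rw [map_smul, hy]⟩

theorem vanishingAt_univ [Fintype ι] (he : CompleteOrthogonalIdempotents e) :
    vanishingAt e Set.univ M = ⊥ := by
  refine eq_bot_iff.2 fun x hx => ?_
  rw [Submodule.mem_bot, ← sum_smul_eq he x]
  exact Finset.sum_eq_zero fun i _ => by simpa using hx i trivial 1

end Generated

/-! ### Homomorphisms out of `P(i)` -/

section Proj

variable {A ι : Type*} [Ring A] {e : ι → A} {M : Type*} [AddCommGroup M] [Module A M]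

/-- The generator `e_i` of `P(i)`. -/
def projGen (e : ι → A) (i : ι) : Proj e i := ⟨e i, Submodule.mem_span_singleton_self _⟩

theorem proj_eq_smul {i : ι} (p : Proj e i) : ∃ a : A, p = a • projGen e i := by
  obtain ⟨a, ha⟩ := Submodule.mem_span_singleton.1 p.2
  exact ⟨a, Subtype.ext ha.symm⟩

theorem smul_projGen {i : ι} (he : IsIdempotentElem (e i)) : e i • projGen e i = projGen e i :=
  Subtype.ext he

/-- The homomorphism `P(i) → M` given by an element of `M`. -/
def projHom (e : ι → A) (i : ι) (x : M) : Proj e i →ₗ[A] M :=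
  (LinearMap.toSpanSingleton A M x) ∘ₗ (Proj e i).subtype

theorem projHom_projGen {i : ι} {x : M} (hx : e i • x = x) :
    projHom e i x (projGen e i) = x := hx

theorem range_projHom {i : ι} {x : M} (hx : e i • x = x) :
    LinearMap.range (projHom e i x) = Submodule.span A {x} := by
  refine le_antisymm ?_ ((Submodule.span_singleton_le_iff_mem _ _).2 ⟨_, projHom_projGen hx⟩)
  rintro _ ⟨p, rfl⟩
  exact Submodule.smul_mem _ _ (Submodule.mem_span_singleton_self x)

theorem generatedAt_proj {i : ι} (he : IsIdempotentElem (e i)) :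
    generatedAt e {i} (Proj e i) = ⊤ := by
  refine eq_top_iff.2 fun p _ => ?_
  obtain ⟨a, rfl⟩ := proj_eq_smul p
  exact Submodule.smul_mem _ _ (Submodule.subset_span ⟨i, rfl, smul_projGen he⟩)

end Proj

/-! ### Composition factors of `P(j)` and `I(j)` -/

section Dimensions

variable {K A ι : Type*} [Field K] [Ring A] [Algebra K A] {e : ι → A}

/-- `dim e_k I(l) = dim e_l A e_k = dim e_l P(k)`. -/
theorem simpleMult_inj (l k : ι) (hl : IsIdempotentElem (e l)) :
    simpleMult K e (Inj K e l) k = simpleMult K e (Proj e k) l := by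
  -- The range of `π` is `e_l A e_k`, which is `e_l P(k)`; the range of its transpose is `e_k I(l)`,
  -- and transposition preserves rank.
  let π : A →ₗ[K] A := LinearMap.mulLeft K (e l) ∘ₗ LinearMap.mulRight K (e k)
  have h₁ : (LinearMap.range (Algebra.lsmul K K (Proj e k) (e l))).map
      ((Proj e k).subtype.restrictScalars K) = LinearMap.range π := by
    ext y
    constructor
    · rintro ⟨_, ⟨p, rfl⟩, rfl⟩
      obtain ⟨a, rfl⟩ := proj_eq_smul p
      exact ⟨a, rfl⟩
    · rintro ⟨a, rfl⟩
      exact ⟨_, ⟨a • projGen e k, rfl⟩, rfl⟩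
  let ρ : Inj K e l →ₗ[K] (A →ₗ[K] K) := (Inj K e l).subtype.restrictScalars K
  have hρ : Function.Injective ρ := (Inj K e l).injective_subtype
  have h₂ : (LinearMap.range (Algebra.lsmul K K (Inj K e l) (e k))).map ρ =
      LinearMap.range π.dualMap := by
    ext y
    constructor
    · rintro ⟨_, ⟨f, rfl⟩, rfl⟩
      exact ⟨ρ f, LinearMap.ext fun x => f.2 (x * e k)⟩
    · rintro ⟨f, rfl⟩
      let g : RegDual K A := f ∘ₗ LinearMap.mulLeft K (e l)
      have hg : g ∈ Inj K e l := fun x => by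
        change f (e l * (e l * x)) = f (e l * x)
        rw [← mul_assoc, hl.eq]
      exact ⟨_, ⟨⟨g, hg⟩, rfl⟩, rfl⟩
  have h₃ := LinearEquiv.finrank_eq (Submodule.equivMapOfInjective
    ((Proj e k).subtype.restrictScalars K) (Proj e k).injective_subtype
    (LinearMap.range (Algebra.lsmul K K (Proj e k) (e l))))
  have h₄ := LinearEquiv.finrank_eq (Submodule.equivMapOfInjective ρ hρ
    (LinearMap.range (Algebra.lsmul K K (Inj K e l) (e k))))
  rw [h₁] at h₃
  rw [h₂, LinearMap.finrank_range_dualMap_eq_finrank_range] at h₄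
  rw [simpleMult, simpleMult, h₃, h₄]

open Classical in
theorem sum_ite_mem_eq_ncard {ι : Type*} [Fintype ι] [PartialOrder ι] (U : Set ι) (k : ι) :
    ∑ i, (if k ≤ i then if i ∈ U then 1 else 0 else 0) = (U ∩ Set.Ici k).ncard := by
  rw [Set.ncard_eq_toFinset_card', Finset.card_eq_sum_ones, Finset.sum_congr rfl fun i _ =>
    (ite_and (k ≤ i) (i ∈ U) 1 0).symm, ← Finset.sum_filter]
  exact Finset.sum_congr (by ext; simp [and_comm]) fun _ _ => rfl

variable [Module.Finite K A] [Fintype ι] [PartialOrder ι] [BoundedOrder ι]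

open Classical in
theorem simpleMult_standard (he : IsOneQuasiHereditary K e) (i k : ι) :
    simpleMult K e (Standard K e i) k = if k ≤ i then 1 else 0 := by
  split_ifs with h
  · exact he.standard_mult i k h
  · exact (isLeast_standardKer K e i).1 k h

/-- A good filtration of `P(j)` has exactly the sections `Δ(i)`, `i ≥ j`, and each contributes one
`S(k)` precisely when `k ≤ i`. -/
theorem simpleMult_proj (he : IsOneQuasiHereditary K e) (j k : ι) :
    simpleMult K e (Proj e j) k = (Set.Ici j ∩ Set.Ici k).ncard := by
  classical
  obtain ⟨r, F, hF⟩ := he.proj_good j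
  rw [simpleMult_eq_sum_filtrationMult he.complete.idem (simpleMult_standard he) hF,
    ← sum_ite_mem_eq_ncard]
  refine Finset.sum_congr rfl fun i _ => ?_
  congr 1
  split_ifs with h
  · exact (he.proj_mult i j h).2 r F hF
  · exact (he.proj_mult_zero j i h).2 r F hF

theorem simpleMult_inj_eq (he : IsOneQuasiHereditary K e) (j k : ι) :
    simpleMult K e (Inj K e j) k = (Set.Ici j ∩ Set.Ici k).ncard := by
  rw [simpleMult_inj j k (he.complete.idem j), simpleMult_proj he,
    Set.inter_comm]

/-- `e_a A e_b ⊆ ∑_{i ≥ a, b} A e_i A e_b`. -/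
theorem smul_mem_generatedAt_Ici_inter (he : IsOneQuasiHereditary K e) (a b : ι)
    (x : Proj e b) : e a • x ∈ generatedAt e (Set.Ici a ∩ Set.Ici b) (Proj e b) := by
  obtain ⟨r, F, hF⟩ := he.proj_good b
  have key : ∀ t ≤ r, ∀ x ∈ F t, e a • x ∈ generatedAt e (Set.Ici a ∩ Set.Ici b) (Proj e b) := by
    intro t
    induction t with
    | zero =>
      intro _ x hx
      rw [hF.1, Submodule.mem_bot] at hx
      rw [hx, smul_zero]
      exact Submodule.zero_mem _
    | succ t ih =>
      intro ht x hx
      obtain ⟨hle, i, ⟨φ⟩⟩ := hF.2.2 t ht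
      have hbi : b ≤ i := by
        by_contra hbi
        have h : filtrationMult (Standard K e) r F i = 0 :=
          (he.proj_mult_zero b i hbi).2 r F hF
        rw [filtrationMult, Set.ncard_eq_zero
          ((Set.finite_lt_nat r).subset fun _ hs => (Set.mem_ofPred_eq ▸ hs).1)] at h
        exact Set.eq_empty_iff_forall_notMem.1 h t ⟨ht, ⟨φ⟩⟩
      by_cases hai : a ≤ i
      -- `Δ(i)` is generated by its `e_i`-part, so modulo `F t` the element `x` may be replaced by
      -- some `z` generated at `i`, an index above both `a` and `b`.
      · let f := φ.toLinearMap ∘ₗ ((F t).submoduleOf (F (t + 1))).mkQ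
        have hf : Function.Surjective f := φ.surjective.comp (Submodule.mkQ_surjective _)
        have hS : generatedAt e {i} (Standard K e i) = ⊤ := by
          rw [← map_generatedAt_of_surjective he.complete.idem _ (Submodule.mkQ_surjective _),
            generatedAt_proj (he.complete.idem i), Submodule.map_top, Submodule.range_mkQ]
        have hx' : f ⟨x, hx⟩ ∈ generatedAt e {i} (Standard K e i) := hS ▸ Submodule.mem_top
        rw [← map_generatedAt_of_surjective he.complete.idem f hf] at hx'
        obtain ⟨z, hz, hzx⟩ := hx'
        have h₁ : x - z ∈ F t :=
          (Submodule.Quotient.eq ((F t).submoduleOf (F (t + 1)))).1 (φ.injective hzx.symm)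
        have h₂ : (z : Proj e b) ∈ generatedAt e (Set.Ici a ∩ Set.Ici b) (Proj e b) :=
          generatedAt_mono (Set.singleton_subset_iff.2 (Set.mem_inter hai hbi))
            (map_generatedAt_le (F (t + 1)).subtype (Submodule.mem_map_of_mem hz))
        rw [← sub_add_cancel x z, smul_add]
        exact Submodule.add_mem _ (ih (by lia) _ h₁) (Submodule.smul_mem _ _ h₂)
      -- Here `e_a` annihilates `Δ(i)`, so `e_a x` already lies in `F t`; idempotence lets the
      -- induction hypothesis apply to it.
      · have h₁ : e a • (Submodule.Quotient.mk ⟨x, hx⟩ :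
            F (t + 1) ⧸ (F t).submoduleOf (F (t + 1))) = 0 := by
          apply φ.injective
          rw [map_smul, map_zero]
          exact smul_eq_zero_of_simpleMult_eq_zero (K := K)
            ((isLeast_standardKer K e i).1 a hai) _
        have h₂ : e a • x ∈ F t :=
          (Submodule.Quotient.mk_eq_zero ((F t).submoduleOf (F (t + 1)))).1 h₁
        have h₃ := ih (by lia) _ h₂
        rwa [smul_smul, (he.complete.idem a).eq] at h₃
  exact key r le_rfl x (hF.2.1 ▸ Submodule.mem_top)

end Dimensions

/-! ### Socles, tops and generators -/

section Cyclic

variable {A ι : Type*} [Ring A] {e : ι → A} {M : Type*} [AddCommGroup M] [Module A M]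

/-- A semisimple module generated by an element of `e_i M` is generated by it at `i` in every
submodule: a submodule on which `e_i` vanishes is zero. -/
theorem eq_bot_of_smul_eq_zero [IsSemisimpleModule A M] {i : ι} {g : M} (hg : e i • g = g)
    (hspan : Submodule.span A {g} = ⊤) {T : Submodule A M} (hT : ∀ x ∈ T, e i • x = 0) :
    T = ⊥ := by
  obtain ⟨T', hT'⟩ := exists_isCompl T
  obtain ⟨t, ht, t', ht', htt⟩ := Submodule.mem_sup.1 (hT'.sup_eq_top ▸ Submodule.mem_top : g ∈ _)
  have hg' : g ∈ T' := by
    rw [← hg, ← htt, smul_add, hT t ht, zero_add]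
    exact T'.smul_mem _ ht'
  have htop : T' = ⊤ := top_le_iff.1 (hspan ▸ (Submodule.span_singleton_le_iff_mem _ _).2 hg')
  have := hT'.inf_eq_bot
  rwa [htop, inf_top_eq] at this

instance isSemisimpleModule_socle : IsSemisimpleModule A (socle A M) := by
  rw [socle, sSup_eq_iSup]
  exact isSemisimpleModule_biSup_of_isSemisimpleModule_submodule fun N hN => by
    have : IsSimpleModule A N := hN
    infer_instance

theorem inf_socle_ne_bot [IsArtinian A M] {N : Submodule A M} (hN : N ≠ ⊥) :
    N ⊓ socle A M ≠ ⊥ := by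
  obtain ⟨S, hS, hSN⟩ := (eq_bot_or_exists_atom_le N).resolve_left hN
  have hS' : S ≤ socle A M := le_sSup (isSimpleModule_iff_isAtom.2 hS)
  exact fun h => hS.1 (le_bot_iff.1 (h ▸ le_inf hSN hS'))

/-- Nakayama's lemma for a generator of the top. -/
theorem span_eq_top_of_span_mk_eq_top [IsNoetherian A M] {x : M}
    (h : Submodule.span A {(Submodule.Quotient.mk x : ModTop A M)} = ⊤) :
    Submodule.span A {x} = ⊤ := by
  refine (eq_top_or_exists_le_coatom (Submodule.span A {x})).resolve_right ?_
  rintro ⟨m, hm, hxm⟩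
  have hJ : Module.jacobson A M ≤ m := sInf_le hm
  refine hm.1 (eq_top_iff.2 fun y _ => ?_)
  obtain ⟨a, ha⟩ := Submodule.mem_span_singleton.1
    (h ▸ Submodule.mem_top : (Submodule.Quotient.mk y : ModTop A M) ∈ _)
  have h₁ : a • x - y ∈ m := hJ ((Submodule.Quotient.eq _).1 ha)
  have h₂ := m.sub_mem (m.smul_mem a (hxm (Submodule.mem_span_singleton_self x))) h₁
  rwa [sub_sub_cancel] at h₂

/-- The image of `e_i` in `S(i)`. -/
def simpGen (e : ι → A) (i : ι) : Simp e i := Submodule.Quotient.mk (projGen e i)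

theorem smul_simpGen {i : ι} (he : IsIdempotentElem (e i)) : e i • simpGen e i = simpGen e i := by
  rw [simpGen, ← Submodule.Quotient.mk_smul, smul_projGen he]

theorem span_simpGen (i : ι) : Submodule.span A {simpGen e i} = ⊤ := by
  refine eq_top_iff.2 fun x _ => ?_
  obtain ⟨p, rfl⟩ := Submodule.Quotient.mk_surjective _ x
  obtain ⟨a, rfl⟩ := proj_eq_smul p
  exact Submodule.smul_mem _ _ (Submodule.mem_span_singleton_self _)

theorem span_equiv_simpGen {i : ι} (σ : M ≃ₗ[A] Simp e i) :
    Submodule.span A {σ.symm (simpGen e i)} = ⊤ := by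
  rw [← Set.image_singleton, ← LinearEquiv.coe_coe, Submodule.span_image, span_simpGen,
    Submodule.map_top, LinearEquiv.range]

end Cyclic

section LeOne

variable {K A ι : Type*} [Field K] [Ring A] [Algebra K A] {e : ι → A}
  {M : Type*} [AddCommGroup M] [Module K M] [Module A M] [IsScalarTower K A M] [Module.Finite K M]

theorem exists_smul_eq_of_simpleMult_le_one {i : ι} (h : simpleMult K e M i ≤ 1) {x : M}
    (hx : e i • x ≠ 0) (y : M) : ∃ c : K, c • e i • x = e i • y := by
  obtain ⟨v, hv⟩ := (finrank_le_one_iff (K := K)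
    (V := LinearMap.range (Algebra.lsmul K K M (e i)))).1 h
  obtain ⟨c, hc⟩ := hv ⟨e i • x, x, rfl⟩
  obtain ⟨d, hd⟩ := hv ⟨e i • y, y, rfl⟩
  have hc' : c • (v : M) = e i • x := congrArg Subtype.val hc
  have hd' : d • (v : M) = e i • y := congrArg Subtype.val hd
  have hc0 : c ≠ 0 := by
    rintro rfl
    exact hx (by rw [← hc', zero_smul])
  exact ⟨d * c⁻¹, by rw [← hc', smul_smul, inv_mul_cancel_right₀ hc0, hd']⟩

end LeOne

/-! ### The submodules `P(l)` and `𝒦(l)` of `P(1)` -/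

section Embedding

variable {K A ι : Type*} [Field K] [Ring A] [Algebra K A] {e : ι → A}

/-- The homomorphism `P(j) → I(i)` given by a functional on `P(j)`. -/
def projToInj {i : ι} (hi : IsIdempotentElem (e i)) (j : ι) (φ : Proj e j →ₗ[K] K) :
    Proj e j →ₗ[A] Inj K e i where
  toFun x := ⟨(φ ∘ₗ ((LinearMap.toSpanSingleton A (Proj e j) x).restrictScalars K) ∘ₗ
    LinearMap.mulLeft K (e i) : A →ₗ[K] K), fun a => by
      change φ ((e i * (e i * a)) • x) = φ ((e i * a) • x)
      rw [← mul_assoc, hi.eq]⟩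
  map_add' x y := Subtype.ext <| DFunLike.ext _ _ fun a => by
    change φ ((e i * a) • (x + y)) = φ ((e i * a) • x) + φ ((e i * a) • y)
    rw [smul_add, map_add]
  map_smul' b x := Subtype.ext <| DFunLike.ext _ _ fun a => by
    change φ ((e i * a) • b • x) = φ ((e i * (a * b)) • x)
    rw [smul_smul, mul_assoc]

theorem projToInj_apply {i : ι} (hi : IsIdempotentElem (e i)) (j : ι) (φ : Proj e j →ₗ[K] K)
    (x : Proj e j) (a : A) : (projToInj hi j φ x : RegDual K A) a = φ ((e i * a) • x) := rfl

/-- A functional in `I(l)` satisfies `f a = f (e_l a) = (e_l • a • f) 1`. -/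
theorem vanishingAt_inj (l : ι) : vanishingAt e {l} (Inj K e l) = ⊥ := by
  refine eq_bot_iff.2 fun f hf => Subtype.ext (DFunLike.ext _ _ fun a => ?_)
  have h : (e l • a • (f : RegDual K A)) 1 = 0 := by
    have h₁ := congrArg (Subtype.val) (hf l rfl a)
    exact congrArg (fun g : RegDual K A => g 1) h₁
  rw [RegDual.smul_apply, RegDual.smul_apply, one_mul] at h
  exact (f.2 a).symm.trans h

variable [Module.Finite K A] [Fintype ι] [PartialOrder ι] [BoundedOrder ι]

/-- The socle of `P(j)` contains an element of `e_1 P(j)` lying in every nonzero submodule. -/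
theorem exists_mem_forall_ne_bot (he : IsOneQuasiHereditary K e) (j : ι) :
    ∃ s : Proj e j, e ⊥ • s = s ∧ s ≠ 0 ∧ ∀ N : Submodule A (Proj e j), N ≠ ⊥ → s ∈ N := by
  have : ∀ i, IsArtinian A (Proj e i) := fun i => isArtinian_of_tower K inferInstance
  obtain ⟨σ⟩ := he.socle_proj j
  obtain ⟨τ⟩ := he.socle_proj ⊤
  have hidem := he.complete.idem ⊥
  set g := σ.symm (simpGen e ⊥) with hgdef
  have hg : e ⊥ • g = g := by rw [hgdef, ← map_smul, smul_simpGen hidem]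
  have hspan : Submodule.span A {g} = ⊤ := span_equiv_simpGen σ
  -- The socles of `P(j)` and `P(⊤)` are isomorphic, and `P(⊤)` contains `S(⊥)` only once; hence
  -- `e_⊥` cuts out at most a line in the socle, and any nonzero vector there recovers `g`.
  have hdim : simpleMult K e (socle A (Proj e j)) ⊥ ≤ 1 := by
    rw [simpleMult_congr (σ.trans τ.symm)]
    refine (simpleMult_le_of_injective (Submodule.subtype _) (Submodule.injective_subtype _)
      hidem).trans ?_
    rw [simpleMult_proj he, Set.Ici_bot, Set.inter_univ, Set.Ici_top, Set.ncard_singleton]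
  have hmem : ∀ N : Submodule A (Proj e j), N ≠ ⊥ → (g : Proj e j) ∈ N := by
    intro N hN
    have hN' : N.submoduleOf (socle A (Proj e j)) ≠ ⊥ := by
      intro h
      refine inf_socle_ne_bot hN (eq_bot_iff.2 fun x hx => ?_)
      have : (⟨x, hx.2⟩ : socle A (Proj e j)) ∈ N.submoduleOf (socle A (Proj e j)) := hx.1
      rw [h, Submodule.mem_bot] at this
      exact congrArg Subtype.val this
    have hx : ∃ x ∈ N.submoduleOf (socle A (Proj e j)), e ⊥ • x ≠ 0 := by
      by_contra! hx
      exact hN' (eq_bot_of_smul_eq_zero hg hspan hx)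
    obtain ⟨x, hxN, hx⟩ := hx
    obtain ⟨c, hc⟩ := exists_smul_eq_of_simpleMult_le_one hdim hx g
    have hgx : g = (algebraMap K A c * e ⊥) • x := by
      rw [mul_smul, algebraMap_smul, hc, hg]
    have : g ∈ N.submoduleOf (socle A (Proj e j)) := hgx ▸ Submodule.smul_mem _ _ hxN
    exact this
  refine ⟨g, congrArg Subtype.val hg, fun h0 => ?_, hmem⟩
  have hne : (⊤ : Submodule A (Proj e j)) ≠ ⊥ := by
    intro h
    have h₁ : projGen e j = 0 := by
      rw [← Submodule.mem_bot (R := A), ← h]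
      exact Submodule.mem_top
    exact (he.primitive j).2.1 (congrArg Subtype.val h₁)
  refine inf_socle_ne_bot hne ?_
  rw [top_inf_eq, ← Submodule.map_subtype_top (socle A (Proj e j)), ← hspan,
    Submodule.map_span, Set.image_singleton, Submodule.subtype_apply, h0,
    Submodule.span_zero_singleton]

/-- A functional nonzero at the common socle element `s` induces a map whose kernel misses `s`, and
every nonzero submodule contains `s`. -/
theorem exists_injective_proj_inj (he : IsOneQuasiHereditary K e) (j : ι) :
    ∃ f : Proj e j →ₗ[A] Inj K e (⊥ : ι), Function.Injective f := by
  obtain ⟨s, hs, hs0, hN⟩ := exists_mem_forall_ne_bot he j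
  obtain ⟨φ, hφ⟩ : ∃ φ : Module.Dual K (Proj e j), φ s ≠ 0 := by
    by_contra! h
    exact hs0 ((Module.forall_dual_apply_eq_zero_iff K s).1 h)
  refine ⟨projToInj (he.complete.idem ⊥) j φ, LinearMap.ker_eq_bot.1 ?_⟩
  by_contra h
  have h₁ := congrArg (fun f : Inj K e (⊥ : ι) => (f : RegDual K A) 1) (hN _ h)
  refine hφ ?_
  change (projToInj (he.complete.idem ⊥) j φ s : RegDual K A) 1 = 0 at h₁
  rwa [projToInj_apply, mul_one, hs] at h₁

/-- `P(l)` embeds in the projective-injective module `P(1) ≅ I(1)`. -/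
theorem exists_injective_proj (he : IsOneQuasiHereditary K e) (l : ι) :
    ∃ f : Proj e l →ₗ[A] Proj e (⊥ : ι), Function.Injective f := by
  obtain ⟨f, hf⟩ := exists_injective_proj_inj he (⊥ : ι)
  obtain ⟨g, hg⟩ := exists_injective_proj_inj he l
  have hs : Function.Surjective f := surjective_of_simpleMult_eq he.complete f hf fun k => by
    rw [simpleMult_proj he, simpleMult_inj_eq he]
  let σ := (LinearEquiv.ofBijective f ⟨hf, hs⟩).symm
  exact ⟨σ.toLinearMap ∘ₗ g, σ.injective.comp hg⟩

theorem simpleMult_proj_bot (he : IsOneQuasiHereditary K e) (k : ι) :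
    simpleMult K e (Proj e (⊥ : ι)) k = (Set.Ici k).ncard := by
  rw [simpleMult_proj he, Set.Ici_bot, Set.univ_inter]

/-- `P(l)` is generated by its `e_l`-part, and it has as many factors `S(l)` as `P(1)`, so `N`
contains all of `e_l P(1)`. -/
theorem eq_generatedAt_of_equiv (he : IsOneQuasiHereditary K e) {l : ι}
    {N : Submodule A (Proj e (⊥ : ι))} (σ : N ≃ₗ[A] Proj e l) :
    N = generatedAt e {l} (Proj e (⊥ : ι)) := by
  refine le_antisymm ?_ (Submodule.span_le.2 ?_)
  · have h := map_generatedAt_le (e := e) (S := {l}) (N.subtype ∘ₗ σ.symm.toLinearMap)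
    rwa [generatedAt_proj (he.complete.idem l), Submodule.map_top, LinearMap.range_comp,
      LinearEquiv.range, Submodule.map_subtype_top] at h
  · rintro x ⟨i, rfl, hx⟩
    have h := smul_mem_of_simpleMult_eq (K := K) N (he.complete.idem i) (by
      rw [simpleMult_congr σ, simpleMult_proj he, simpleMult_proj_bot he, Set.inter_self]) x
    rwa [hx] at h

theorem nonempty_generatedAt_equiv (he : IsOneQuasiHereditary K e) (l : ι) :
    Nonempty (generatedAt e {l} (Proj e (⊥ : ι)) ≃ₗ[A] Proj e l) := by
  obtain ⟨f, hf⟩ := exists_injective_proj he l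
  have σ := (LinearEquiv.ofInjective f hf).symm
  exact ⟨eq_generatedAt_of_equiv he σ ▸ σ⟩

theorem projIn_eq (he : IsOneQuasiHereditary K e) (l : ι) :
    projIn e l = generatedAt e {l} (Proj e (⊥ : ι)) :=
  le_antisymm (sSup_le fun _ ⟨σ⟩ => (eq_generatedAt_of_equiv he σ).le)
    (le_sSup (nonempty_generatedAt_equiv he l))

/-- A generator of the top `S(1)` is lifted by Nakayama; multiplying the lift by `e_⊥` makes it the
image of the generator of `P(1)`. -/
theorem exists_inj_generator (he : IsOneQuasiHereditary K e) (l : ι) :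
    ∃ f : Inj K e l, e ⊥ • f = f ∧ Submodule.span A {f} = ⊤ := by
  have : IsNoetherian A (Inj K e l) := isNoetherian_of_tower K inferInstance
  obtain ⟨τ⟩ := he.top_inj l
  obtain ⟨f, hf⟩ := Submodule.Quotient.mk_surjective _ (τ.symm (simpGen e ⊥))
  refine ⟨e ⊥ • f, by rw [smul_smul, (he.complete.idem ⊥).eq],
    span_eq_top_of_span_mk_eq_top ?_⟩
  rw [Submodule.Quotient.mk_smul, hf, ← map_smul, smul_simpGen (he.complete.idem ⊥),
    span_equiv_simpGen]

theorem exists_surjective_inj (he : IsOneQuasiHereditary K e) (l : ι) :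
    ∃ f : Proj e (⊥ : ι) →ₗ[A] Inj K e l, Function.Surjective f := by
  obtain ⟨f, hf, hspan⟩ := exists_inj_generator he l
  exact ⟨projHom e ⊥ f, LinearMap.range_eq_top.1 ((range_projHom hf).trans hspan)⟩

/-- `I(l)` uses up all factors `S(l)` of `P(1)`, so `N` has none. Conversely a submodule without
`S(l)` maps to zero in `I(l)`, by `vanishingAt_inj`. -/
theorem eq_vanishingAt_of_equiv (he : IsOneQuasiHereditary K e) {l : ι}
    {N : Submodule A (Proj e (⊥ : ι))} (σ : (Proj e (⊥ : ι) ⧸ N) ≃ₗ[A] Inj K e l) :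
    N = vanishingAt e {l} (Proj e (⊥ : ι)) := by
  refine le_antisymm ?_ fun x hx => ?_
  · have h := simpleMult_eq_add (K := K) N (he.complete.idem l)
    rw [simpleMult_congr σ, simpleMult_inj_eq he, simpleMult_proj_bot he, Set.inter_self] at h
    rintro x hx i rfl a
    exact congrArg Subtype.val (smul_eq_zero_of_simpleMult_eq_zero (K := K) (M := N)
      (by lia : simpleMult K e N i = 0) ⟨a • x, N.smul_mem a hx⟩)
  · have h : σ (Submodule.Quotient.mk x) ∈ vanishingAt e {l} (Inj K e l) := fun i hi a => by
      rw [← map_smul, ← map_smul, ← Submodule.Quotient.mk_smul, ← Submodule.Quotient.mk_smul,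
        hx i hi a, Submodule.Quotient.mk_zero, map_zero]
    rw [vanishingAt_inj, Submodule.mem_bot, LinearEquiv.map_eq_zero_iff] at h
    exact (Submodule.Quotient.mk_eq_zero N).1 h

theorem nonempty_quotient_vanishingAt_equiv (he : IsOneQuasiHereditary K e) (l : ι) :
    Nonempty ((Proj e (⊥ : ι) ⧸ vanishingAt e {l} (Proj e (⊥ : ι))) ≃ₗ[A] Inj K e l) := by
  obtain ⟨f, hf⟩ := exists_surjective_inj he l
  have σ := f.quotKerEquivOfSurjective hf
  exact ⟨eq_vanishingAt_of_equiv he σ ▸ σ⟩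

theorem injKer_eq (he : IsOneQuasiHereditary K e) (l : ι) :
    injKer K e l = vanishingAt e {l} (Proj e (⊥ : ι)) :=
  le_antisymm (sInf_le (nonempty_quotient_vanishingAt_equiv he l))
    (le_sInf fun _ ⟨σ⟩ => (eq_vanishingAt_of_equiv he σ).ge)

end Embedding

/-! ### Counting in upper sets -/

section UpperSets

variable {ι : Type*}

theorem ncard_inter_eq_add [Finite ι] {U V : Set ι} (h : V ⊆ U) (S : Set ι) :
    (U ∩ S).ncard = (V ∩ S).ncard + (U \ V ∩ S).ncard := by
  rw [← Set.ncard_union_eq]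
  · congr 1
    ext x
    have := @h x
    simp only [Set.mem_inter_iff, Set.mem_sdiff, Set.mem_union]
    tauto
  · exact Set.disjoint_left.2 fun x hx hx' => hx'.1.2 hx.1

variable [PartialOrder ι]

theorem isUpperSet_upClosure (L : Set ι) : IsUpperSet (upClosure L) :=
  isUpperSet_iUnion₂ fun i _ => isUpperSet_Ici i

theorem subset_upClosure (L : Set ι) : L ⊆ upClosure L :=
  fun _ hi => Set.mem_biUnion hi Set.self_mem_Ici

theorem Ici_inter_Ici_subset {U : Set ι} {m j : ι} (hm : m ∈ U) (hU : IsUpperSet U)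
    (hj : ¬ j ≤ m) : Set.Ici j ∩ Set.Ici m ⊆ U \ {m} := by
  rintro i ⟨hji, hmi⟩
  refine ⟨hU hmi hm, ?_⟩
  rintro rfl
  exact hj hji

variable [Finite ι]

/-- An upper set containing the upper set `V` is obtained from `V` by adding one element at a
time. -/
theorem upperSet_induction {V : Set ι} (hV : IsUpperSet V) {motive : Set ι → Prop}
    (base : motive V)
    (step : ∀ U m, m ∈ U → IsUpperSet U → IsUpperSet (U \ {m}) → motive (U \ {m}) → motive U)
    {U : Set ι} (hU : IsUpperSet U) (h : V ⊆ U) : motive U := by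
  induction hn : (U \ V).ncard using Nat.strong_induction_on generalizing U with
  | _ n ih =>
    rcases (U \ V).eq_empty_or_nonempty with hE | hE
    · rwa [(Set.sdiff_eq_empty.1 hE).antisymm h]
    -- Minimality of `m` in `U \ V` keeps `U \ {m}` upper: an element of `U` strictly below `m`
    -- would lie in `V`, and so would `m`.
    · obtain ⟨m, hm⟩ := (U \ V).toFinite.exists_minimal hE
      have hU' : IsUpperSet (U \ {m}) := by
        rintro a b hab ⟨ha, ham⟩
        refine ⟨hU hab ha, ?_⟩
        rintro rfl
        exact ham (hm.eq_of_le ⟨ha, fun haV => hm.prop.2 (hV hab haV)⟩ hab)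
      have hV' : V ⊆ U \ {m} := fun x hx => ⟨h hx, by rintro rfl; exact hm.prop.2 hx⟩
      refine step U m hm.prop.1 hU hU' (ih _ ?_ hU' hV' rfl)
      rw [← hn]
      exact Set.ncard_lt_ncard ⟨fun x hx => ⟨hx.1.1, hx.2⟩, fun hs => (hs hm.prop).1.2 rfl⟩

open Classical in
theorem ncard_inter_Ici_eq_add {U : Set ι} {m : ι} (hm : m ∈ U) (k : ι) :
    (U ∩ Set.Ici k).ncard = (U \ {m} ∩ Set.Ici k).ncard + if k ≤ m then 1 else 0 := by
  split_ifs with h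
  · rw [← Set.inter_sdiff_right_comm]
    exact (Set.ncard_sdiff_singleton_add_one (Set.mem_inter hm h)).symm
  · congr 1
    ext x
    simp only [Set.mem_inter_iff, Set.mem_sdiff, Set.mem_singleton_iff, Set.mem_Ici]
    grind

open Classical in
/-- A function on upper sets which grows at most by `[k ≤ m]` when `m` is added and which has the
maximal possible value at the largest upper set is a counting function. -/
theorem eq_ncard_of_step {c : Set ι → ℕ} {k : ι} (h0 : c ∅ = 0)
    (huniv : c Set.univ = (Set.Ici k).ncard)
    (hstep : ∀ U m, m ∈ U → IsUpperSet U → IsUpperSet (U \ {m}) →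
      c U ≤ c (U \ {m}) + if k ≤ m then 1 else 0) {U : Set ι} (hU : IsUpperSet U) :
    c U = (U ∩ Set.Ici k).ncard := by
  -- The difference `c U - |U ∩ Ici k|` is antitone in `U` and vanishes at both `∅` and `univ`,
  -- hence everywhere.
  have key : ∀ {V U : Set ι}, IsUpperSet V → IsUpperSet U → V ⊆ U →
      c U + (V ∩ Set.Ici k).ncard ≤ c V + (U ∩ Set.Ici k).ncard := by
    intro V U hV hU h
    refine upperSet_induction hV (motive := fun U =>
      c U + (V ∩ Set.Ici k).ncard ≤ c V + (U ∩ Set.Ici k).ncard) le_rfl ?_ hU h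
    intro U m hm hU hU' ih
    have h₁ := hstep U m hm hU hU'
    have h₂ := ncard_inter_Ici_eq_add hm k
    lia
  have h₁ := key isUpperSet_empty hU (Set.empty_subset U)
  have h₂ := key hU isUpperSet_univ (Set.subset_univ U)
  rw [Set.empty_inter, Set.ncard_empty, h0] at h₁
  rw [Set.univ_inter, huniv] at h₂
  lia

open Classical in
theorem ncard_sdiff_sdiff_singleton {U : Set ι} {m : ι} (hm : m ∈ U) (k : ι) :
    (U \ (U \ {m}) ∩ Set.Ici k).ncard = if k ≤ m then 1 else 0 := by
  have h₁ := ncard_inter_Ici_eq_add hm k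
  have h₂ := ncard_inter_eq_add (Set.sdiff_subset (s := U) (t := {m})) (Set.Ici k)
  lia

end UpperSets

/-! ### One-vertex steps and their subquotients -/

section Steps

variable {K A ι : Type*} [Field K] [Ring A] [Algebra K A] [Module.Finite K A] {e : ι → A}
  [Fintype ι] [PartialOrder ι] [BoundedOrder ι]

/-- For `k ≥ i` the submodule `P(i)` has as many factors `S(k)` as `P(1)`, so `e_k P(1) ⊆ P(i)`. -/
theorem generatedAt_upClosure (he : IsOneQuasiHereditary K e) (L : Set ι) :
    generatedAt e (upClosure L) (Proj e (⊥ : ι)) = generatedAt e L (Proj e (⊥ : ι)) := by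
  refine le_antisymm (Submodule.span_le.2 ?_) (generatedAt_mono (subset_upClosure L))
  rintro x ⟨k, hk, hx⟩
  obtain ⟨i, hi, hik⟩ := Set.mem_iUnion₂.1 hk
  obtain ⟨σ⟩ := nonempty_generatedAt_equiv he i
  have h := smul_mem_of_simpleMult_eq (K := K) (generatedAt e {i} (Proj e (⊥ : ι)))
    (he.complete.idem k) (by
      rw [simpleMult_congr σ, simpleMult_proj he, simpleMult_proj_bot he,
        Set.inter_eq_right.2 (Set.Ici_subset_Ici.2 hik)]) x
  rw [hx] at h
  exact generatedAt_mono (Set.singleton_subset_iff.2 hi) h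

/-- For `k ≥ i` the quotient `I(i)` takes all factors `S(k)` of `P(1)`, leaving none for `𝒦(i)`. -/
theorem vanishingAt_upClosure (he : IsOneQuasiHereditary K e) (L : Set ι) :
    vanishingAt e (upClosure L) (Proj e (⊥ : ι)) = vanishingAt e L (Proj e (⊥ : ι)) := by
  refine le_antisymm (vanishingAt_anti (subset_upClosure L)) fun x hx k hk a => ?_
  obtain ⟨i, hi, hik⟩ := Set.mem_iUnion₂.1 hk
  obtain ⟨σ⟩ := nonempty_quotient_vanishingAt_equiv he i
  have h := simpleMult_eq_add (K := K) (vanishingAt e {i} (Proj e (⊥ : ι))) (he.complete.idem k)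
  rw [simpleMult_congr σ, simpleMult_inj_eq he, simpleMult_proj_bot he,
    Set.inter_eq_right.2 (Set.Ici_subset_Ici.2 hik)] at h
  have h' : simpleMult K e (vanishingAt e {i} (Proj e (⊥ : ι))) k = 0 := by lia
  exact congrArg Subtype.val (smul_eq_zero_of_simpleMult_eq_zero h'
    ⟨a • x, Submodule.smul_mem _ a (vanishingAt_anti (Set.singleton_subset_iff.2 hi) hx)⟩)

/-- `∑_{l ∈ U} P(l) / ∑_{l ∈ U \ {m}} P(l)` is a quotient of `Δ(m)`. -/
theorem exists_surjective_standard (he : IsOneQuasiHereditary K e) {U : Set ι} {m : ι}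
    (hm : m ∈ U) (hU : IsUpperSet U) :
    ∃ f : Standard K e m →ₗ[A] (generatedAt e U (Proj e (⊥ : ι)) ⧸
      (generatedAt e (U \ {m}) (Proj e (⊥ : ι))).submoduleOf (generatedAt e U (Proj e (⊥ : ι)))),
      Function.Surjective f := by
  obtain ⟨σ⟩ := nonempty_generatedAt_equiv he m
  have hle : generatedAt e {m} (Proj e (⊥ : ι)) ≤ generatedAt e U (Proj e (⊥ : ι)) :=
    generatedAt_mono (Set.singleton_subset_iff.2 hm)
  let B := (generatedAt e (U \ {m}) (Proj e (⊥ : ι))).submoduleOf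
    (generatedAt e U (Proj e (⊥ : ι)))
  let ψ : Proj e m →ₗ[A] generatedAt e U (Proj e (⊥ : ι)) :=
    Submodule.inclusion hle ∘ₗ σ.symm.toLinearMap
  let q := B.mkQ ∘ₗ ψ
  -- For `¬ j ≤ m`, `e_j P(m)` is generated at indices above both `j` and `m`; these lie in `U \
  -- {m}`, so it dies in the quotient.
  have hq : standardKer K e m ≤ LinearMap.ker q := by
    refine sInf_le fun j hj => ?_
    rw [simpleMult_eq_zero_iff]
    intro x
    obtain ⟨p, rfl⟩ := Submodule.Quotient.mk_surjective _ x
    rw [← Submodule.Quotient.mk_smul, Submodule.Quotient.mk_eq_zero, LinearMap.mem_ker]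
    refine (Submodule.Quotient.mk_eq_zero B).2 ?_
    exact generatedAt_mono (Ici_inter_Ici_subset hm hU hj)
      (map_generatedAt_le ((Submodule.subtype _) ∘ₗ ψ)
        (Submodule.mem_map_of_mem (smul_mem_generatedAt_Ici_inter he j m p)))
  refine ⟨(standardKer K e m).liftQ q hq, ?_⟩
  intro y
  obtain ⟨⟨x, hx⟩, rfl⟩ := Submodule.Quotient.mk_surjective _ y
  have hx' := hx
  rw [← Set.insert_sdiff_self_of_mem hm, Set.insert_eq, generatedAt_union] at hx'
  obtain ⟨y, hy, z, hz, hyz⟩ := Submodule.mem_sup.1 hx'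
  refine ⟨Submodule.Quotient.mk (σ ⟨y, hy⟩), ?_⟩
  refine (Submodule.Quotient.eq B).2 ?_
  change ((σ.symm (σ ⟨y, hy⟩) : generatedAt e {m} (Proj e (⊥ : ι))) : Proj e (⊥ : ι)) - x ∈
    generatedAt e (U \ {m}) (Proj e (⊥ : ι))
  rw [σ.symm_apply_apply, ← hyz, sub_add_cancel_left]
  exact Submodule.neg_mem _ hz

/-- `⋂_{l ∈ U \ {m}} 𝒦(l) / ⋂_{l ∈ U} 𝒦(l)` is a submodule of `∇(m)`. -/
theorem exists_injective_costandard (he : IsOneQuasiHereditary K e) {U : Set ι} {m : ι}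
    (hm : m ∈ U) (hU : IsUpperSet U) :
    ∃ f : (vanishingAt e (U \ {m}) (Proj e (⊥ : ι)) ⧸
      (vanishingAt e U (Proj e (⊥ : ι))).submoduleOf
        (vanishingAt e (U \ {m}) (Proj e (⊥ : ι)))) →ₗ[A] Costandard K e m,
      Function.Injective f := by
  obtain ⟨σ⟩ := nonempty_quotient_vanishingAt_equiv he m
  let V := vanishingAt e (U \ {m}) (Proj e (⊥ : ι))
  let g : V →ₗ[A] Inj K e m :=
    σ.toLinearMap ∘ₗ (vanishingAt e {m} (Proj e (⊥ : ι))).mkQ ∘ₗ V.subtype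
  have hg : ∀ x, g x ∈ Costandard K e m := by
    have hle : LinearMap.range g ≤ Costandard K e m := by
      refine le_sSup fun j hj => ?_
      rw [simpleMult_eq_zero_iff]
      rintro ⟨_, x, rfl⟩
      have hS := Ici_inter_Ici_subset hm hU hj
      -- Generators of this submodule have the form `w = e_i w` with `i ∈ U \ {m}`, and `e_i w x =
      -- 0` for every `x` in `V`.
      have hz : ∀ z ∈ generatedAt e (Set.Ici m ∩ Set.Ici j) (Proj e j), (z : A) • g x = 0 := by
        intro z hz
        induction hz using Submodule.span_induction with
        | mem w hw =>
          obtain ⟨i, hi, hw⟩ := hw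
          have hx : e i • (w : A) • x = 0 :=
            Subtype.ext (x.2 i (hS (Set.inter_comm _ _ ▸ hi)) w)
          rw [← hw, Submodule.coe_smul, smul_eq_mul, mul_smul, ← map_smul, ← map_smul, hx,
            map_zero]
        | zero => exact zero_smul A _
        | add w w' _ _ h h' => rw [Submodule.coe_add, add_smul, h, h', add_zero]
        | smul a w _ h => rw [Submodule.coe_smul, smul_eq_mul, mul_smul, h, smul_zero]
      refine Subtype.ext (Subtype.ext (DFunLike.ext _ _ fun y => ?_))
      -- The value of `e_j • g x` at `y` is `g x (e_m y e_j)`, and `e_m y e_j` is one of the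
      -- elements `z` above; evaluate `z • g x = 0` at `1`.
      have h := congrArg (fun f : Inj K e m => (f : RegDual K A) 1)
        (hz _ (smul_mem_generatedAt_Ici_inter he m j (y • projGen e j)))
      change (g x : RegDual K A) (1 * (e m * (y * e j))) = 0 at h
      rw [one_mul, (g x).2] at h
      exact h
    exact fun x => hle ⟨x, rfl⟩
  let f := g.codRestrict (Costandard K e m) hg
  have hf : LinearMap.ker f = (vanishingAt e U (Proj e (⊥ : ι))).submoduleOf V := by
    ext x
    have h₁ : x ∈ LinearMap.ker f ↔ (x : Proj e (⊥ : ι)) ∈ vanishingAt e {m} (Proj e (⊥ : ι)) := by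
      rw [LinearMap.ker_codRestrict, LinearMap.mem_ker]
      change σ (Submodule.Quotient.mk (x : Proj e (⊥ : ι))) = 0 ↔ _
      rw [LinearEquiv.map_eq_zero_iff, Submodule.Quotient.mk_eq_zero]
    rw [h₁]
    constructor
    · intro hx i hi
      by_cases him : i = m
      · exact hx i him
      · exact x.2 i ⟨hi, him⟩
    · exact fun hx => vanishingAt_anti (Set.singleton_subset_iff.2 hm) hx
  exact ⟨Submodule.liftQ _ f hf.ge, LinearMap.ker_eq_bot.1 (Submodule.ker_liftQ_eq_bot _ _ _ hf.le)⟩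

/-- Steps bounded by `Δ(m)` must fill up all of `P(1)` when `U` is everything, so `eq_ncard_of_step`
makes the bounds sharp. -/
theorem simpleMult_generatedAt (he : IsOneQuasiHereditary K e) {U : Set ι} (hU : IsUpperSet U)
    (k : ι) :
    simpleMult K e (generatedAt e U (Proj e (⊥ : ι))) k = (U ∩ Set.Ici k).ncard := by
  classical
  refine eq_ncard_of_step (c := fun U => simpleMult K e (generatedAt e U (Proj e (⊥ : ι))) k)
    ?_ ?_ ?_ hU
  · rw [generatedAt_empty, simpleMult_bot]
  · have h : generatedAt e Set.univ (Proj e (⊥ : ι)) = ⊤ := top_le_iff.1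
      ((generatedAt_proj (he.complete.idem ⊥)).ge.trans (generatedAt_mono (Set.subset_univ _)))
    change simpleMult K e (generatedAt e Set.univ (Proj e (⊥ : ι))) k = _
    rw [h, simpleMult_top, simpleMult_proj_bot he]
  · intro U m hm hU _
    obtain ⟨f, hf⟩ := exists_surjective_standard he hm hU
    have h := simpleMult_le_of_surjective (K := K) f hf (he.complete.idem k)
    rw [simpleMult_standard he] at h
    have h' := simpleMult_submoduleOf (K := K)
      (generatedAt_mono (e := e) (M := Proj e (⊥ : ι)) (Set.sdiff_subset (s := U) (t := {m})))
      (he.complete.idem k)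
    lia

-- `∇(m)` is a quotient of `∇(⊤) ⊆ I(⊤)`, in which every simple module occurs at most once.
open Classical in
theorem simpleMult_costandard_le (he : IsOneQuasiHereditary K e) (m k : ι) :
    simpleMult K e (Costandard K e m) k ≤ if k ≤ m then 1 else 0 := by
  split_ifs with h
  · obtain ⟨f, hf⟩ := he.costandard_covers m
    refine (simpleMult_le_of_surjective f hf (he.complete.idem k)).trans
      ((simpleMult_le_of_injective (Submodule.subtype _) (Submodule.injective_subtype _)
        (he.complete.idem k)).trans ?_)
    rw [simpleMult_inj_eq he, Set.Ici_top]
    exact (Set.ncard_le_ncard Set.inter_subset_left).trans (Set.ncard_singleton _).le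
  · exact ((isGreatest_costandard K e m).1 k h).le

theorem simpleMult_quotient_vanishingAt (he : IsOneQuasiHereditary K e) {U : Set ι}
    (hU : IsUpperSet U) (k : ι) :
    simpleMult K e (Proj e (⊥ : ι) ⧸ vanishingAt e U (Proj e (⊥ : ι))) k =
      (U ∩ Set.Ici k).ncard := by
  classical
  have hadd := fun U : Set ι =>
    simpleMult_eq_add (K := K) (vanishingAt e U (Proj e (⊥ : ι))) (he.complete.idem k)
  refine eq_ncard_of_step
    (c := fun U => simpleMult K e (Proj e (⊥ : ι) ⧸ vanishingAt e U (Proj e (⊥ : ι))) k)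
    ?_ ?_ ?_ hU
  · have h := hadd ∅
    have h' : simpleMult K e (vanishingAt e ∅ (Proj e (⊥ : ι))) k =
        simpleMult K e (Proj e (⊥ : ι)) k := by rw [vanishingAt_empty, simpleMult_top]
    lia
  · have h := hadd Set.univ
    have h' : simpleMult K e (vanishingAt e Set.univ (Proj e (⊥ : ι))) k = 0 := by
      rw [vanishingAt_univ he.complete, simpleMult_bot]
    rw [simpleMult_proj_bot he, h'] at h
    lia
  · intro U m hm hU _
    obtain ⟨f, hf⟩ := exists_injective_costandard he hm hU
    have h₁ := (simpleMult_le_of_injective (K := K) f hf (he.complete.idem k)).trans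
      (simpleMult_costandard_le he m k)
    have h₂ := simpleMult_submoduleOf (K := K)
      (vanishingAt_anti (e := e) (M := Proj e (⊥ : ι)) (Set.sdiff_subset (s := U) (t := {m})))
      (he.complete.idem k)
    have h₃ := hadd U
    have h₄ := hadd (U \ {m})
    lia

theorem simpleMult_generatedAt_quotient (he : IsOneQuasiHereditary K e) {U V : Set ι}
    (hU : IsUpperSet U) (hV : IsUpperSet V) (h : V ⊆ U) (k : ι) :
    simpleMult K e (generatedAt e U (Proj e (⊥ : ι)) ⧸
      (generatedAt e V (Proj e (⊥ : ι))).submoduleOf (generatedAt e U (Proj e (⊥ : ι)))) k =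
      (U \ V ∩ Set.Ici k).ncard := by
  have h₁ := simpleMult_submoduleOf (K := K)
    (generatedAt_mono (e := e) (M := Proj e (⊥ : ι)) h) (he.complete.idem k)
  rw [simpleMult_generatedAt he hU, simpleMult_generatedAt he hV,
    ncard_inter_eq_add h (Set.Ici k)] at h₁
  lia

theorem simpleMult_vanishingAt_quotient (he : IsOneQuasiHereditary K e) {U V : Set ι}
    (hU : IsUpperSet U) (hV : IsUpperSet V) (h : V ⊆ U) (k : ι) :
    simpleMult K e (vanishingAt e V (Proj e (⊥ : ι)) ⧸
      (vanishingAt e U (Proj e (⊥ : ι))).submoduleOf (vanishingAt e V (Proj e (⊥ : ι)))) k =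
      (U \ V ∩ Set.Ici k).ncard := by
  have h₁ := simpleMult_submoduleOf (K := K)
    (vanishingAt_anti (e := e) (M := Proj e (⊥ : ι)) h) (he.complete.idem k)
  have h₂ := simpleMult_eq_add (K := K) (vanishingAt e U (Proj e (⊥ : ι))) (he.complete.idem k)
  have h₃ := simpleMult_eq_add (K := K) (vanishingAt e V (Proj e (⊥ : ι))) (he.complete.idem k)
  rw [simpleMult_quotient_vanishingAt he hU] at h₂
  rw [simpleMult_quotient_vanishingAt he hV] at h₃
  have h₄ := ncard_inter_eq_add h (Set.Ici k)
  lia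

-- The lower bound comes from the step removing `m` from `Ici m`: its subquotient embeds in `∇(m)`
-- and already has the full count.
open Classical in
theorem simpleMult_costandard (he : IsOneQuasiHereditary K e) (m k : ι) :
    simpleMult K e (Costandard K e m) k = if k ≤ m then 1 else 0 := by
  refine le_antisymm (simpleMult_costandard_le he m k) ?_
  have hm : m ∈ Set.Ici m := Set.self_mem_Ici
  obtain ⟨f, hf⟩ := exists_injective_costandard he hm (isUpperSet_Ici m)
  have h := simpleMult_le_of_injective (K := K) f hf (he.complete.idem k)
  rwa [simpleMult_vanishingAt_quotient he (isUpperSet_Ici m)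
    (by rw [Set.Ici_sdiff_left]; exact isUpperSet_Ioi m) Set.sdiff_subset,
    ncard_sdiff_sdiff_singleton hm] at h

theorem isGood_generatedAt_quotient (he : IsOneQuasiHereditary K e) {U V : Set ι}
    (hU : IsUpperSet U) (hV : IsUpperSet V) (h : V ⊆ U) :
    IsGood A (Standard K e) (generatedAt e U (Proj e (⊥ : ι)) ⧸
      (generatedAt e V (Proj e (⊥ : ι))).submoduleOf (generatedAt e U (Proj e (⊥ : ι)))) := by
  classical
  refine isGood_of_chain (upperSet_induction hV (motive := fun U =>
    Relation.ReflTransGen (IsStep (Standard K e)) (generatedAt e V (Proj e (⊥ : ι)))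
      (generatedAt e U (Proj e (⊥ : ι)))) .refl ?_ hU h)
  intro U m hm hU hU' ih
  refine ih.tail ⟨generatedAt_mono Set.sdiff_subset, m, ?_⟩
  obtain ⟨f, hf⟩ := exists_surjective_standard he hm hU
  exact ⟨(LinearEquiv.ofBijective f ⟨injective_of_simpleMult_eq (K := K) he.complete f hf
    fun k => by rw [simpleMult_standard he,
      simpleMult_generatedAt_quotient he hU hU' Set.sdiff_subset,
      ncard_sdiff_sdiff_singleton hm], hf⟩).symm⟩

theorem isGood_vanishingAt_quotient (he : IsOneQuasiHereditary K e) {U V : Set ι}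
    (hU : IsUpperSet U) (hV : IsUpperSet V) (h : V ⊆ U) :
    IsGood A (fun i => Costandard K e i) (vanishingAt e V (Proj e (⊥ : ι)) ⧸
      (vanishingAt e U (Proj e (⊥ : ι))).submoduleOf (vanishingAt e V (Proj e (⊥ : ι)))) := by
  classical
  refine isGood_of_chain (upperSet_induction hV (motive := fun U =>
    Relation.ReflTransGen (IsStep fun i => Costandard K e i) (vanishingAt e U (Proj e (⊥ : ι)))
      (vanishingAt e V (Proj e (⊥ : ι)))) .refl ?_ hU h)
  intro U m hm hU hU' ih
  -- `vanishingAt` reverses inclusions, so the new subquotient is attached at the bottom of the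
  -- chain.
  refine .head ⟨vanishingAt_anti Set.sdiff_subset, m, ?_⟩ ih
  obtain ⟨f, hf⟩ := exists_injective_costandard he hm hU
  exact ⟨LinearEquiv.ofBijective f ⟨hf, surjective_of_simpleMult_eq (K := K) he.complete f hf
    fun k => by rw [simpleMult_costandard he,
      simpleMult_vanishingAt_quotient he hU hU' Set.sdiff_subset,
      ncard_sdiff_sdiff_singleton hm]⟩⟩

theorem projSum_eq (he : IsOneQuasiHereditary K e) (L : Set ι) :
    projSum e L = generatedAt e (upClosure L) (Proj e (⊥ : ι)) := by
  rw [generatedAt_upClosure he, generatedAt_eq_iSup, projSum]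
  simp only [projIn_eq he]

theorem injKerInf_eq (he : IsOneQuasiHereditary K e) (L : Set ι) :
    injKerInf K e L = vanishingAt e (upClosure L) (Proj e (⊥ : ι)) := by
  rw [vanishingAt_upClosure he, vanishingAt_eq_iInf, injKerInf]
  simp only [injKer_eq he]

end Steps

end QuasiHereditary

/-! ### The theorem on sums and intersections -/

theorem mainTheorem9 {K A ι : Type*} [Field K] [IsAlgClosed K] [Ring A] [Algebra K A]
    [Module.Finite K A] [Fintype ι] [PartialOrder ι] [BoundedOrder ι] (e : ι → A)
    (he : IsOneQuasiHereditary K e) :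
    -- `P(l)` embeds in `P(1)` with a unique image, `projIn e l`
    (∀ l, ∃! N : Submodule A (Proj e (⊥ : ι)),
      Nonempty (N ≃ₗ[A] Proj e l)) ∧
    -- `P(1)` surjects onto `I(l)` with a unique kernel, `injKer K e l`
    (∀ l, ∃! N : Submodule A (Proj e (⊥ : ι)),
      Nonempty ((Proj e (⊥ : ι) ⧸ N) ≃ₗ[A] Inj K e l)) ∧
    ∀ L₁ L₂ : Set ι, upClosure L₂ ⊆ upClosure L₁ →
      ∀ M₁ M₂ N₁ N₂ : Submodule A (Proj e (⊥ : ι)),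
      M₁ = projSum e L₁ → M₂ = projSum e L₂ →
      N₁ = injKerInf K e L₁ → N₂ = injKerInf K e L₂ →
      (M₂ ≤ M₁ ∧
        (upClosure L₂ ⊂ upClosure L₁ → M₂ < M₁) ∧
        IsGood A (Standard K e) (M₁ ⧸ M₂.submoduleOf M₁) ∧
        (∀ k ∈ upClosure L₁ \ upClosure L₂,
          HasGoodMult A (Standard K e)
            (M₁ ⧸ M₂.submoduleOf M₁) k 1) ∧
        (∀ k ∉ upClosure L₁ \ upClosure L₂,
          HasGoodMult A (Standard K e)
            (M₁ ⧸ M₂.submoduleOf M₁) k 0)) ∧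
      (N₁ ≤ N₂ ∧
        (upClosure L₂ ⊂ upClosure L₁ → N₁ < N₂) ∧
        IsGood A (fun i => Costandard K e i)
          (N₂ ⧸ N₁.submoduleOf N₂) ∧
        (∀ k ∈ upClosure L₁ \ upClosure L₂,
          HasGoodMult A (fun i => Costandard K e i)
            (N₂ ⧸ N₁.submoduleOf N₂) k 1) ∧
        (∀ k ∉ upClosure L₁ \ upClosure L₂,
          HasGoodMult A (fun i => Costandard K e i)
            (N₂ ⧸ N₁.submoduleOf N₂) k 0)) := by
  classical
  refine ⟨fun l => ⟨_, nonempty_generatedAt_equiv he l, fun N ⟨σ⟩ => eq_generatedAt_of_equiv he σ⟩,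
    fun l => ⟨_, nonempty_quotient_vanishingAt_equiv he l,
      fun N ⟨σ⟩ => eq_vanishingAt_of_equiv he σ⟩, ?_⟩
  rintro L₁ L₂ h _ _ _ _ rfl rfl rfl rfl
  rw [projSum_eq he, projSum_eq he, injKerInf_eq he, injKerInf_eq he]
  have hU := isUpperSet_upClosure L₁
  have hV := isUpperSet_upClosure L₂
  generalize upClosure L₁ = U at h hU
  generalize upClosure L₂ = V at h hV
  have := finite_submodule K (Proj e (⊥ : ι))
  have := fun N : Submodule A (Proj e (⊥ : ι)) => finite_submodule K N
  have := fun N N' : Submodule A (Proj e (⊥ : ι)) => finite_quotient K (N.submoduleOf N')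
  have hM := isGood_generatedAt_quotient he hU hV h
  have hN := isGood_vanishingAt_quotient he hU hV h
  have hMm := hasGoodMult_of_simpleMult (K := K) (c := fun i => if i ∈ U \ V then 1 else 0)
    he.complete.idem (simpleMult_standard he) hM fun k => by
      rw [simpleMult_generatedAt_quotient he hU hV h]
      convert (sum_ite_mem_eq_ncard (U \ V) k).symm
  have hNm := hasGoodMult_of_simpleMult (K := K) (c := fun i => if i ∈ U \ V then 1 else 0)
    he.complete.idem (simpleMult_costandard he) hN fun k => by
      rw [simpleMult_vanishingAt_quotient he hU hV h]
      convert (sum_ite_mem_eq_ncard (U \ V) k).symm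
  -- Strictness is detected by `S(⊥)`, whose multiplicity counts all elements of `U \ V`.
  have hne : V ⊂ U → 0 < (U \ V ∩ Set.Ici (⊥ : ι)).ncard := fun hs => by
    rw [Set.Ici_bot, Set.inter_univ, Set.ncard_pos]
    exact Set.nonempty_of_ssubset hs
  refine ⟨⟨generatedAt_mono h, fun hs => lt_of_le_of_ne (generatedAt_mono h) fun heq => ?_, hM,
      fun k hk => ?_, fun k hk => ?_⟩,
    ⟨vanishingAt_anti h, fun hs => lt_of_le_of_ne (vanishingAt_anti h) fun heq => ?_, hN,
      fun k hk => ?_, fun k hk => ?_⟩⟩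
  · have h₁ := simpleMult_generatedAt he hU ⊥
    rw [← heq, simpleMult_generatedAt he hV, ncard_inter_eq_add h] at h₁
    exact absurd (hne hs) (by lia)
  · simpa [hk] using hMm k
  · simpa only [if_neg hk] using hMm k
  · have h₁ := simpleMult_quotient_vanishingAt he hU ⊥
    rw [heq, simpleMult_quotient_vanishingAt he hV, ncard_inter_eq_add h] at h₁
    exact absurd (hne hs) (by lia)
  · simpa only [if_pos hk] using hNm k
  · simpa only [if_neg hk] using hNm k
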